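/- Let $N\ge 2$ and let $D\subset\mathbb R^N$ be an unbounded domain (a nonempty, open, connected, unbounded set; $D=\mathbb R^N$ is allowed). Let $\sigma:D\to\mathbb R$ be measurable with $0<\mu\le\sigma(x)\le M$ for every $x\in D$, where $\mu,M$ are constants. Let $\lambda>0$ be a constant and let $w\in H^1_{loc}(D)\cap L^\infty(D)\cap C^0(\overline D)$ satisfy $$-\mathrm{div}(\sigma\nabla w)+\lambda w\ge 0\ \text{ in } D\qquad\text{and}\qquad w\ge 0\ \text{ on }\partial D,$$ where the differential inequality is understood in the weak sense, that is, $$\int_D\left(\sigma\,\nabla w\cdot\nabla\varphi+\lambda w\varphi\right)dx\ge 0\quad\text{for every } \varphi\in C_c^\infty(D)\text{ with }\varphi\ge 0.$$ Then $w\ge 0$ in $D$, and moreover either $w>0$ everywhere in $D$ or $w\equiv 0$ in $D$. -/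

import Mathlib

open MeasureTheory TopologicalSpace
open scoped Distributions Gradient

/-- `f ∈ L²_loc(D)`: `f` is square integrable on every compact subset of the open set `D`. -/
def MemL2Loc {E F : Type*} [TopologicalSpace E] [MeasureSpace E] [NormedAddCommGroup F]
    (D : Opens E) (f : E → F) : Prop :=
  ∀ K : Set E, IsCompact K → K ⊆ (D : Set E) → MemLp f 2 (volume.restrict K)

/-- `G` is the weak (distributional) gradient of `w` in `D`, with `w` and `G` both in
`L²_loc(D)`: for every smooth `φ` with compact support in `D` and every coordinate `i`,
`∫_D w ∂ᵢφ = - ∫_D Gᵢ φ`. -/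
structure HasH1LocGradient {N : ℕ} (D : Opens (EuclideanSpace ℝ (Fin N)))
    (w : EuclideanSpace ℝ (Fin N) → ℝ)
    (G : EuclideanSpace ℝ (Fin N) → EuclideanSpace ℝ (Fin N)) : Prop where
  memL2Loc : MemL2Loc D w
  memL2Loc_grad : MemL2Loc D G
  integral_eq : ∀ (φ : 𝓓(D, ℝ)) (i : Fin N),
    ∫ x in (D : Set (EuclideanSpace ℝ (Fin N))), w x * (∇ φ x) i =
      - ∫ x in (D : Set (EuclideanSpace ℝ (Fin N))), G x i * φ x

/-- `w ∈ H¹_loc(D)`. -/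
def MemH1Loc {N : ℕ} (D : Opens (EuclideanSpace ℝ (Fin N)))
    (w : EuclideanSpace ℝ (Fin N) → ℝ) : Prop :=
  ∃ G : EuclideanSpace ℝ (Fin N) → EuclideanSpace ℝ (Fin N), HasH1LocGradient D w G

/-- `-div(σ∇w) + lam w ≥ 0` in `D` in the weak sense: `w` has a weak gradient `G` in `D` (which is
unique up to null sets) and `∫_D (σ G·∇φ + lam w φ) ≥ 0` for every nonnegative smooth `φ` with
compact support in `D`. -/
def IsWeakSupersolution {N : ℕ} (D : Opens (EuclideanSpace ℝ (Fin N)))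
    (σ : EuclideanSpace ℝ (Fin N) → ℝ) (lam : ℝ)
    (w : EuclideanSpace ℝ (Fin N) → ℝ) : Prop :=
  ∃ G : EuclideanSpace ℝ (Fin N) → EuclideanSpace ℝ (Fin N), HasH1LocGradient D w G ∧
    ∀ φ : 𝓓(D, ℝ), (∀ x, 0 ≤ φ x) →
      0 ≤ ∫ x in (D : Set (EuclideanSpace ℝ (Fin N))),
        (σ x * inner ℝ (G x) (∇ φ x) + lam * w x * φ x)

open Filter Topology Metric Set
open scoped ENNReal NNReal Convolution ContDiff

/-! Both conclusions rest on one energy inequality, `IsEllipticSupersolution.caccioppoli`. With p =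
(k - w)₊, testing the weak inequality with η² p³ and absorbing the cross term gives 2μ ∫ p² η² |G|²
≤ ∫ (M p⁴ |∇η|² + lam w p³ η²). The cube makes s ↦ (k - s)₊³ a C¹ function, so only the chain rule
for C¹ functions of w is needed. That rule follows by mollifying w locally (`HasC1Approx`), and no
theory of truncations of Sobolev functions enters.

Nonnegativity: take k = -δ < 0. Where p > 0 the zero-order term is at most -lam p⁴ η². Since w ≥ 0
on the boundary, {w ≤ -δ} meets each closed ball in a compact subset of D, so η may act there as a
cutoff between large balls. If consecutive radii differ by a large enough L, the integral of p⁴ over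
the ball of radius nL is at most half of that over the ball of radius (n+1)L. As w is bounded these
integrals grow polynomially in n, which forces them to vanish; then δ → 0.

Strong alternative: once w ≥ 0, for k > 0 the right-hand side is at most a constant times k⁴ |{w <
k}|. Two consequences carry the argument. By De Giorgi iteration with the L¹ Sobolev inequality, if
{w < k} occupies a small enough part of a ball, with a threshold independent of k, then w ≥ k/2 at
the centre (`exists_measure_threshold`). By a Poincaré inequality applied to a steep transition
between the levels 0 and k, if w is positive somewhere in a ball then its zero set there is null
(`volume_zero_set_eq_zero`). In that case |{w < k}| → 0 as k → 0, so the threshold is eventually met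
and the centre has w > 0. Hence {w > 0} is open and relatively closed in D, and connectedness
concludes. -/

theorem exists_seq_contDiffBump_rOut_lt (E : Type*) [NormedAddCommGroup E] {r : ℝ} (hr : 0 < r) :
    ∃ ρ : ℕ → ContDiffBump (0 : E), (∀ n, (ρ n).rOut < r) ∧
      Tendsto (fun n => (ρ n).rOut) atTop (𝓝 0) := by
  have hpos : ∀ n : ℕ, 0 < r / (n + 2) := fun n => by positivity
  refine ⟨fun n => ⟨r / (n + 2) / 2, r / (n + 2), half_pos (hpos n), half_lt_self (hpos n)⟩, ?_, ?_⟩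
  · intro n
    have : (0 : ℝ) ≤ n := n.cast_nonneg
    exact div_lt_self hr (by linarith)
  · exact tendsto_const_nhds.div_atTop
      (tendsto_atTop_add_const_right _ _ tendsto_natCast_atTop_atTop)

/-! ### Convergence of mollifications in L² -/

section Mollification

variable {E F : Type*} [NormedAddCommGroup E] [InnerProductSpace ℝ E] [FiniteDimensional ℝ E]
  [MeasurableSpace E] [BorelSpace E] [NormedAddCommGroup F]

/-- Translations act continuously on `L²`. -/
theorem tendsto_eLpNorm_translate_sub {f : E → F} (hf : MemLp f 2 volume) :
    Tendsto (fun t : E => eLpNorm (fun x => f (x - t) - f x) 2 volume) (𝓝 0) (𝓝 0) := by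
  let g : E → C(E, E) := fun t => ⟨fun x => x - t, by fun_prop⟩
  have hg : Continuous g := by
    have : Continuous (Function.uncurry fun t x : E => x - t) := by fun_prop
    exact ContinuousMap.continuous_of_continuous_uncurry g this
  have hgm : ∀ t, MeasurePreserving (g t) (volume : Measure E) volume :=
    fun t => measurePreserving_sub_right volume t
  have h2 : Fact ((1 : ℝ≥0∞) ≤ 2) := ⟨by norm_num⟩
  have hc : Continuous fun t => Lp.compMeasurePreserving (g t) (hgm t) (hf.toLp f) :=
    continuous_const.compMeasurePreservingLp hg hgm (by norm_num)
  have h0 := (hc.sub continuous_const).tendsto (0 : E) |>.enorm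
    (f := fun t => Lp.compMeasurePreserving (g t) (hgm t) (hf.toLp f) - hf.toLp f)
  have key : ∀ t, ‖Lp.compMeasurePreserving (g t) (hgm t) (hf.toLp f) - hf.toLp f‖ₑ =
      eLpNorm (fun x => f (x - t) - f x) 2 volume := by
    intro t
    rw [Lp.toLp_compMeasurePreserving, ← MemLp.toLp_sub, Lp.enorm_toLp]
    rfl
  have h1 : Tendsto (fun t : E => eLpNorm (fun x => f (x - t) - f x) 2 volume) (𝓝 0)
      (𝓝 (eLpNorm (fun x => f (x - 0) - f x) 2 volume)) := by
    rw [← key 0]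
    exact h0.congr key
  simpa using h1

variable [NormedSpace ℝ F] [CompleteSpace F]

/-- Jensen's inequality for the square: the mollifier is a probability density, so the difference is
an average of `f (x - t) - f x`. -/
theorem enorm_convolution_sub_sq_le (ρ : ContDiffBump (0 : E)) {f : E → F}
    (hfm : StronglyMeasurable f) (hf : LocallyIntegrable f volume) (x : E) :
    ‖(ρ.normed volume ⋆[ContinuousLinearMap.lsmul ℝ ℝ, volume] f) x - f x‖ₑ ^ (2 : ℝ) ≤
      ∫⁻ t, ‖ρ.normed volume t‖ₑ * ‖f (x - t) - f x‖ₑ ^ (2 : ℝ) := by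
  set r : E → ℝ := ρ.normed volume with hr
  have hrc : Continuous r := ρ.continuous_normed
  have hr1 : ∫⁻ t, ‖r t‖ₑ = 1 := by
    have h1 : ∫ t, r t = 1 := ρ.integral_normed
    have h2 : ∫⁻ t, ‖r t‖ₑ = ∫⁻ t, ENNReal.ofReal (r t) := by
      refine lintegral_congr fun t => ?_
      exact Real.enorm_of_nonneg (ρ.nonneg_normed t)
    rw [h2, ← ofReal_integral_eq_lintegral_ofReal ρ.integrable_normed
      (ae_of_all _ fun t => ρ.nonneg_normed t), h1, ENNReal.ofReal_one]
  have hint : Integrable (fun t => r t • f (x - t)) volume := by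
    have := (ρ.hasCompactSupport_normed (μ := volume)).convolutionExists_left
      (ContinuousLinearMap.lsmul ℝ ℝ) hrc hf x
    exact this
  have hint2 : Integrable (fun t => r t • f x) volume := ρ.integrable_normed.smul_const _
  have heq : (r ⋆[ContinuousLinearMap.lsmul ℝ ℝ, volume] f) x - f x =
      ∫ t, r t • (f (x - t) - f x) := by
    simp only [smul_sub]
    rw [integral_sub hint hint2, ρ.integral_normed_smul]
    rfl
  have hb : Measurable fun t => ‖f (x - t) - f x‖ₑ := by
    have : StronglyMeasurable fun t => f (x - t) :=
      hfm.comp_measurable (measurable_const.sub measurable_id)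
    exact (this.sub stronglyMeasurable_const).enorm
  have hrm : Measurable fun t => ‖r t‖ₑ := hrc.measurable.enorm
  -- Since ν has mass 1, Hölder's inequality against the constant 1 bounds the square of the mean by
  -- the mean of the square.
  let ν : Measure E := volume.withDensity fun t => ‖r t‖ₑ
  have hν : ν univ = 1 := by simp [ν, hr1]
  have hCS := ENNReal.lintegral_mul_le_Lp_mul_Lq ν Real.HolderConjugate.two_two
    (f := fun t => ‖f (x - t) - f x‖ₑ) (g := fun _ => 1) hb.aemeasurable aemeasurable_const
  simp only [Pi.mul_apply, mul_one, ENNReal.one_rpow, lintegral_const, hν] at hCS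
  rw [heq]
  calc ‖∫ t, r t • (f (x - t) - f x)‖ₑ ^ (2 : ℝ)
      ≤ (∫⁻ t, ‖r t‖ₑ * ‖f (x - t) - f x‖ₑ) ^ (2 : ℝ) := by
        gcongr
        refine (enorm_integral_le_lintegral_enorm _).trans (lintegral_mono fun t => ?_)
        rw [enorm_smul]
    _ = (∫⁻ t, ‖f (x - t) - f x‖ₑ ∂ν) ^ (2 : ℝ) := by
        rw [lintegral_withDensity_eq_lintegral_mul _ hrm hb]; rfl
    _ ≤ ((∫⁻ t, ‖f (x - t) - f x‖ₑ ^ (2 : ℝ) ∂ν) ^ (1 / (2 : ℝ))) ^ (2 : ℝ) := by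
        gcongr
    _ = ∫⁻ t, ‖f (x - t) - f x‖ₑ ^ (2 : ℝ) ∂ν := by
        rw [← ENNReal.rpow_mul]; norm_num
    _ = _ := by
        rw [lintegral_withDensity_eq_lintegral_mul _ hrm (hb.pow_const _)]; rfl

/-- Integrating the pointwise Jensen bound in x and exchanging the integrals leaves an average of
squared translation errors over the support of the mollifier. -/
theorem eLpNorm_convolution_sub_le (ρ : ContDiffBump (0 : E)) {f : E → F}
    (hf : MemLp f 2 volume) {ε : ℝ≥0∞}
    (hε : ∀ t ∈ ball (0 : E) ρ.rOut, eLpNorm (fun x => f (x - t) - f x) 2 volume ≤ ε) :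
    eLpNorm (fun x => (ρ.normed volume ⋆[ContinuousLinearMap.lsmul ℝ ℝ, volume] f) x - f x) 2
      volume ≤ ε := by
  -- Exchanging the integrals needs joint measurability of (x, t) ↦ f (x - t) - f x, hence a
  -- strongly measurable representative.
  wlog hfm : StronglyMeasurable f generalizing f
  · have hae := hf.1.ae_eq_mk
    have hq : ∀ t : E, (fun x => f (x - t)) =ᵐ[volume] fun x => hf.1.mk f (x - t) :=
      fun t => (measurePreserving_sub_right volume t).quasiMeasurePreserving.ae_eq_comp hae
    have := this (f := hf.1.mk f) ((memLp_congr_ae hae).1 hf) (fun t ht => by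
      refine le_trans (le_of_eq (eLpNorm_congr_ae ?_)) (hε t ht)
      filter_upwards [hae, hq t] with x h1 h2
      rw [h1, h2]) hf.1.stronglyMeasurable_mk
    refine le_trans (le_of_eq (eLpNorm_congr_ae ?_)) this
    rw [convolution_congr (ContinuousLinearMap.lsmul ℝ ℝ) (ae_eq_refl _) hae]
    filter_upwards [hae] with x h1
    rw [h1]
  have hloc : LocallyIntegrable f volume := hf.locallyIntegrable (by norm_num)
  have hrc : Continuous (ρ.normed volume) := ρ.continuous_normed
  have hsq : ∀ g : E → F, eLpNorm g 2 volume ^ (2 : ℝ) = ∫⁻ x, ‖g x‖ₑ ^ (2 : ℝ) := by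
    intro g
    have := eLpNorm_nnreal_pow_eq_lintegral (μ := (volume : Measure E)) (f := g) (p := 2) (by simp)
    simpa using this
  have hmeas : Measurable fun p : E × E =>
      ‖ρ.normed volume p.2‖ₑ * ‖f (p.1 - p.2) - f p.1‖ₑ ^ (2 : ℝ) := by
    have h1 : StronglyMeasurable fun p : E × E => f (p.1 - p.2) :=
      hfm.comp_measurable (measurable_fst.sub measurable_snd)
    have h2 : StronglyMeasurable fun p : E × E => f p.1 := hfm.comp_measurable measurable_fst
    exact ((hrc.measurable.comp measurable_snd).enorm).mul ((h1.sub h2).enorm.pow_const _)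
  have hr1 : ∫⁻ t, ‖ρ.normed volume t‖ₑ = 1 := by
    have h2 : ∫⁻ t, ‖ρ.normed volume t‖ₑ = ∫⁻ t, ENNReal.ofReal (ρ.normed volume t) := by
      refine lintegral_congr fun t => ?_
      exact Real.enorm_of_nonneg (ρ.nonneg_normed t)
    rw [h2, ← ofReal_integral_eq_lintegral_ofReal ρ.integrable_normed
      (ae_of_all _ fun t => ρ.nonneg_normed t), ρ.integral_normed, ENNReal.ofReal_one]
  rw [← ENNReal.rpow_le_rpow_iff (z := 2) (by norm_num), hsq]
  calc ∫⁻ x, ‖(ρ.normed volume ⋆[ContinuousLinearMap.lsmul ℝ ℝ, volume] f) x - f x‖ₑ ^ (2 : ℝ)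
      ≤ ∫⁻ x, ∫⁻ t, ‖ρ.normed volume t‖ₑ * ‖f (x - t) - f x‖ₑ ^ (2 : ℝ) :=
        lintegral_mono fun x => enorm_convolution_sub_sq_le ρ hfm hloc x
    _ = ∫⁻ t, ∫⁻ x, ‖ρ.normed volume t‖ₑ * ‖f (x - t) - f x‖ₑ ^ (2 : ℝ) :=
        lintegral_lintegral_swap hmeas.aemeasurable
    _ ≤ ∫⁻ t, ‖ρ.normed volume t‖ₑ * ε ^ (2 : ℝ) := by
        refine lintegral_mono fun t => ?_
        rw [lintegral_const_mul' _ _ (by simp)]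
        by_cases ht : t ∈ ball (0 : E) ρ.rOut
        · gcongr
          rw [← hsq]
          gcongr
          exact hε t ht
        · have : ρ.normed volume t = 0 := by
            rw [← ρ.support_normed_eq (μ := volume)] at ht
            simpa using ht
          simp [this]
    _ = ε ^ (2 : ℝ) := by rw [lintegral_mul_const _ hrc.measurable.enorm, hr1, one_mul]

/-- Mollification converges in `L²`. -/
theorem tendsto_eLpNorm_convolution_sub {ι : Type*} {l : Filter ι} {ρ : ι → ContDiffBump (0 : E)}
    (hρ : Tendsto (fun i => (ρ i).rOut) l (𝓝 0)) {f : E → F} (hf : MemLp f 2 volume) :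
    Tendsto (fun i => eLpNorm (fun x =>
      ((ρ i).normed volume ⋆[ContinuousLinearMap.lsmul ℝ ℝ, volume] f) x - f x) 2 volume)
      l (𝓝 0) := by
  rw [ENNReal.tendsto_nhds_zero]
  intro ε hε
  have h1 := (ENNReal.tendsto_nhds_zero.1 (tendsto_eLpNorm_translate_sub hf)) ε hε
  obtain ⟨δ, hδ, hb⟩ := Metric.eventually_nhds_iff_ball.1 h1
  filter_upwards [hρ.eventually (gt_mem_nhds hδ)] with i hi
  exact eLpNorm_convolution_sub_le (ρ i) hf fun t ht => hb t (ball_subset_ball hi.le ht)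

end Mollification

/-! ### Local C¹ approximation of w and its weak gradient -/

/-- The pair `(w, G)` is locally a limit of pairs `(W n, ∇ (W n))` with `W n` of class `C¹`:
`W n → w` uniformly and `∇ (W n) → G` in `L²` on every compact subset of `D`. -/
structure HasC1Approx {E : Type*} [NormedAddCommGroup E] [InnerProductSpace ℝ E] [CompleteSpace E]
    [MeasureSpace E] (D : Opens E) (w : E → ℝ) (G : E → E) : Prop where
  continuousOn : ContinuousOn w D
  memL2Loc_grad : MemL2Loc D G
  exists_seq : ∀ K : Set E, IsCompact K → K ⊆ D → ∃ W : ℕ → E → ℝ,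
    (∀ n, ContDiff ℝ 1 (W n)) ∧ TendstoUniformlyOn W w atTop K ∧
      Tendsto (fun n => eLpNorm (fun x => ∇ (W n) x - G x) 2 (volume.restrict K)) atTop (𝓝 0)

theorem gradient_apply_eq_fderiv_single {N : ℕ} (f : EuclideanSpace ℝ (Fin N) → ℝ)
    (x : EuclideanSpace ℝ (Fin N)) (i : Fin N) :
    (∇ f x) i = fderiv ℝ f x (EuclideanSpace.single i 1) := by
  rw [← inner_gradient_left, EuclideanSpace.inner_single_right]
  simp

/-- Inside `K`, the gradient of a mollification is the mollification of the weak gradient. -/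
theorem HasH1LocGradient.gradient_convolution {N : ℕ} {D : Opens (EuclideanSpace ℝ (Fin N))}
    {w : EuclideanSpace ℝ (Fin N) → ℝ} {G : EuclideanSpace ℝ (Fin N) → EuclideanSpace ℝ (Fin N)}
    (h : HasH1LocGradient D w G) {K : Set (EuclideanSpace ℝ (Fin N))} (hK : IsCompact K)
    (hKD : K ⊆ D) (ρ : ContDiffBump (0 : EuclideanSpace ℝ (Fin N)))
    {x : EuclideanSpace ℝ (Fin N)} (hx : closedBall x ρ.rOut ⊆ K) :
    ∇ (ρ.normed volume ⋆[ContinuousLinearMap.lsmul ℝ ℝ, volume] K.indicator w) x =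
      (ρ.normed volume ⋆[ContinuousLinearMap.lsmul ℝ ℝ, volume] K.indicator G) x := by
  set r : EuclideanSpace ℝ (Fin N) → ℝ := ρ.normed volume with hr
  have hrs : ContDiff ℝ ∞ r := ρ.contDiff_normed
  have hrc : HasCompactSupport r := ρ.hasCompactSupport_normed
  have hKm := hK.measurableSet
  have hw : LocallyIntegrable (K.indicator w) volume :=
    ((memLp_indicator_iff_restrict hKm).2 (h.memL2Loc K hK hKD)).locallyIntegrable (by norm_num)
  have hG : LocallyIntegrable (K.indicator G) volume :=
    ((memLp_indicator_iff_restrict hKm).2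
      (h.memL2Loc_grad K hK hKD)).locallyIntegrable (by norm_num)
  have hsupp : ∀ y, y ∉ K → r (x - y) = 0 := by
    intro y hy
    have : x - y ∉ Function.support r := by
      rw [hr, ρ.support_normed_eq]
      intro h'
      refine hy (hx ?_)
      rw [mem_closedBall, dist_comm, dist_eq_norm]
      exact (mem_ball_zero_iff.1 h').le
    simpa using this
  have hsuppb : (fun y => r (x - y)).support ⊆ closedBall x ρ.rOut := by
    intro y hy
    have hy' : x - y ∈ Function.support r := hy
    rw [hr, ρ.support_normed_eq] at hy'
    rw [mem_closedBall, dist_comm, dist_eq_norm]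
    exact (mem_ball_zero_iff.1 hy').le
  have htsupp : tsupport (fun y => r (x - y)) ⊆ closedBall x ρ.rOut :=
    closure_minimal hsuppb isClosed_closedBall
  -- The reflected kernel y ↦ r (x - y) is an admissible test function because its support lies in K
  -- ⊆ D. Its y-derivative is minus the derivative of r, which cancels the sign in the definition of
  -- the weak gradient.
  let φ : 𝓓(D, ℝ) :=
    { toFun := fun y => r (x - y)
      contDiff' := by
        have : ContDiff ℝ ∞ fun y : EuclideanSpace ℝ (Fin N) => x - y :=
          contDiff_const.sub contDiff_id
        exact hrs.comp this
      hasCompactSupport' :=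
        (isCompact_closedBall x ρ.rOut).of_isClosed_subset (isClosed_tsupport _) htsupp
      tsupport_subset' := htsupp.trans (hx.trans hKD) }
  have hφ : ∀ y, φ y = r (x - y) := fun y => rfl
  have hφg : ∀ y i, (∇ φ y) i = - fderiv ℝ r (x - y) (EuclideanSpace.single i 1) := by
    intro y i
    rw [gradient_apply_eq_fderiv_single]
    have h1 : HasFDerivAt r (fderiv ℝ r (x - y)) (x - y) :=
      (hrs.differentiable (by simp) _).hasFDerivAt
    have h2 : HasFDerivAt (fun y : EuclideanSpace ℝ (Fin N) => x - y)
        (-ContinuousLinearMap.id ℝ (EuclideanSpace ℝ (Fin N))) y := (hasFDerivAt_id y).const_sub x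
    have h3 := h1.comp y h2
    rw [show (φ : EuclideanSpace ℝ (Fin N) → ℝ) = r ∘ fun y => x - y from rfl, h3.fderiv]
    simp
  ext i
  have hint := h.integral_eq φ i
  have hfd := hrc.hasFDerivAt_convolution_left (ContinuousLinearMap.lsmul ℝ ℝ)
    (hrs.of_le (by simp)) hw x
  rw [gradient_apply_eq_fderiv_single, hfd.fderiv]
  have hrfc : HasCompactSupport (fderiv ℝ r) := hrc.fderiv ℝ
  have hci : Integrable (fun t => ((ContinuousLinearMap.lsmul ℝ ℝ).precompL
      (EuclideanSpace ℝ (Fin N)) : _ →L[ℝ] ℝ →L[ℝ] _) (fderiv ℝ r t)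
        (K.indicator w (x - t))) volume :=
    hrfc.convolutionExists_left _ (hrs.continuous_fderiv (by simp)) hw x
  have hcG : Integrable (fun t => r t • K.indicator G (x - t)) volume :=
    hrc.convolutionExists_left (ContinuousLinearMap.lsmul ℝ ℝ) hrs.continuous hG x
  have hL : (fderiv ℝ r ⋆[(ContinuousLinearMap.lsmul ℝ ℝ).precompL (EuclideanSpace ℝ (Fin N)),
      volume] K.indicator w) x (EuclideanSpace.single i 1) =
      ∫ y, fderiv ℝ r (x - y) (EuclideanSpace.single i 1) * K.indicator w y := by
    rw [convolution_def, ContinuousLinearMap.integral_apply hci,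
      ← integral_sub_left_eq_self _ volume x]
    refine integral_congr_ae (ae_of_all _ fun t => ?_)
    simp [ContinuousLinearMap.precompL_apply]
  have hR : ((r ⋆[ContinuousLinearMap.lsmul ℝ ℝ, volume] K.indicator G) x) i =
      ∫ y, r (x - y) * (K.indicator G y) i := by
    have := (EuclideanSpace.proj (𝕜 := ℝ) i : EuclideanSpace ℝ (Fin N) →L[ℝ] ℝ).integral_comp_comm
      hcG
    rw [convolution_def]
    refine Eq.trans this.symm ?_
    rw [← integral_sub_left_eq_self _ volume x]
    refine integral_congr_ae (ae_of_all _ fun t => ?_)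
    simp
  rw [hL, hR]
  have hDm : MeasurableSet (D : Set (EuclideanSpace ℝ (Fin N))) := D.isOpen.measurableSet
  have hL' : ∫ y in (D : Set (EuclideanSpace ℝ (Fin N))), w y * (∇ φ y) i =
      - ∫ y, fderiv ℝ r (x - y) (EuclideanSpace.single i 1) * K.indicator w y := by
    rw [← integral_indicator hDm, ← integral_neg]
    refine integral_congr_ae (ae_of_all _ fun y => ?_)
    by_cases hy : y ∈ K
    · simp [hy, hKD hy, hφg]; ring
    · have hz : fderiv ℝ r (x - y) = 0 := by
        by_contra hne
        have h1 : x - y ∈ tsupport r := support_fderiv_subset ℝ hne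
        rw [hr, ρ.tsupport_normed_eq, mem_closedBall_zero_iff] at h1
        exact hy (hx (by rwa [mem_closedBall, dist_comm, dist_eq_norm]))
      by_cases hyD : y ∈ (D : Set (EuclideanSpace ℝ (Fin N)))
      · simp [hyD, hy, hφg, hz]
      · simp [hyD, hy]
  have hR' : ∫ y in (D : Set (EuclideanSpace ℝ (Fin N))), G y i * φ y =
      ∫ y, r (x - y) * (K.indicator G y) i := by
    rw [← integral_indicator hDm]
    refine integral_congr_ae (ae_of_all _ fun y => ?_)
    by_cases hy : y ∈ K
    · simp [hy, hKD hy, hφ]; ring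
    · by_cases hyD : y ∈ (D : Set (EuclideanSpace ℝ (Fin N)))
      · simp [hyD, hy, hφ, hsupp y hy]
      · simp [hyD, hy]
  rw [hL', hR'] at hint
  linarith

/-- The approximants are mollifications of w cut off to a compact thickening of K inside D, so that
near K they see only values of w and G on that thickening. Uniform continuity there gives uniform
convergence on K, and L² convergence of mollifications handles the gradients. -/
theorem HasH1LocGradient.hasC1Approx {N : ℕ} {D : Opens (EuclideanSpace ℝ (Fin N))}
    {w : EuclideanSpace ℝ (Fin N) → ℝ} {G : EuclideanSpace ℝ (Fin N) → EuclideanSpace ℝ (Fin N)}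
    (h : HasH1LocGradient D w G) (hwc : ContinuousOn w D) : HasC1Approx D w G := by
  refine ⟨hwc, h.memL2Loc_grad, fun K hK hKD => ?_⟩
  obtain ⟨r, hr, hrD⟩ := hK.exists_cthickening_subset_open D.isOpen hKD
  set K' := cthickening r K with hK'
  have hK'c : IsCompact K' := hK.cthickening
  have hball : ∀ x ∈ K, closedBall x r ⊆ K' := fun x hx => closedBall_subset_cthickening hx r
  have hm := hK'c.measurableSet
  have hw2 : MemLp (K'.indicator w) 2 volume :=
    (memLp_indicator_iff_restrict hm).2 (h.memL2Loc K' hK'c hrD)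
  have hG2 : MemLp (K'.indicator G) 2 volume :=
    (memLp_indicator_iff_restrict hm).2 (h.memL2Loc_grad K' hK'c hrD)
  obtain ⟨ρ, hρr, hρ⟩ := exists_seq_contDiffBump_rOut_lt (EuclideanSpace ℝ (Fin N)) hr
  refine ⟨fun n => (ρ n).normed volume ⋆[ContinuousLinearMap.lsmul ℝ ℝ, volume] K'.indicator w,
    fun n => ?_, ?_, ?_⟩
  · exact (ρ n).hasCompactSupport_normed.contDiff_convolution_left (n := 1) _
      (ρ n).contDiff_normed (hw2.locallyIntegrable (by norm_num))
  · rw [Metric.tendstoUniformlyOn_iff]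
    intro ε hε
    have huc := hK'c.uniformContinuousOn_of_continuous (hwc.mono hrD)
    obtain ⟨δ, hδ, hd⟩ := Metric.uniformContinuousOn_iff.1 huc (ε / 2) (half_pos hε)
    filter_upwards [hρ.eventually (gt_mem_nhds hδ)] with n hn x hx
    have hxK' : x ∈ K' := self_subset_cthickening K hx
    have := (ρ n).dist_normed_convolution_le (μ := volume) (g := K'.indicator w) (x₀ := x)
      (ε := ε / 2) hw2.1 (fun y hy => by
        have hyK' : y ∈ K' := hball x hx (ball_subset_closedBall
          (ball_subset_ball (hρr n).le hy))
        rw [indicator_of_mem hyK', indicator_of_mem hxK']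
        exact (hd y hyK' x hxK' ((mem_ball.1 hy).trans hn)).le)
    rw [indicator_of_mem hxK'] at this
    rw [dist_comm]
    linarith
  · refine tendsto_of_tendsto_of_tendsto_of_le_of_le tendsto_const_nhds
      (tendsto_eLpNorm_convolution_sub hρ hG2) (fun _ => bot_le) fun n => ?_
    refine le_trans (le_of_eq ?_) (eLpNorm_mono_measure _ (Measure.restrict_le_self (s := K)))
    refine eLpNorm_congr_ae ?_
    filter_upwards [ae_restrict_mem hK.measurableSet] with x hx
    rw [h.gradient_convolution hK'c hrD (ρ n)
      ((closedBall_subset_closedBall (hρr n).le).trans (hball x hx)),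
      indicator_of_mem (self_subset_cthickening K hx)]

/-! ### Gradient calculus and uniform convergence -/

section Calculus

variable {E : Type*} [NormedAddCommGroup E] [InnerProductSpace ℝ E] [CompleteSpace E]

theorem gradient_mul_comp {η W : E → ℝ} {h h' : ℝ → ℝ} {x : E} (hη : DifferentiableAt ℝ η x)
    (hW : DifferentiableAt ℝ W x) (hh : HasDerivAt h (h' (W x)) (W x)) :
    ∇ (fun x => η x * h (W x)) x = h (W x) • ∇ η x + (η x * h' (W x)) • ∇ W x := by
  refine HasGradientAt.gradient ?_
  rw [hasGradientAt_iff_hasFDerivAt, map_add, map_smul, map_smul, toDual_gradient, toDual_gradient]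
  have h1 := hη.hasFDerivAt.mul (hh.comp_hasFDerivAt x hW.hasFDerivAt)
  rw [smul_smul, add_comm] at h1
  exact h1

theorem tsupport_gradient_subset (f : E → ℝ) : tsupport (∇ f) ⊆ tsupport f := by
  refine closure_minimal (fun x hx => ?_) (isClosed_tsupport f)
  refine support_fderiv_subset ℝ (f := f) fun h => hx ?_
  rw [gradient, h, map_zero]

theorem ContDiff.continuous_gradient {f : E → ℝ} (hf : ContDiff ℝ 1 f) : Continuous (∇ f) :=
  (InnerProductSpace.toDual ℝ E).symm.continuous.comp (hf.continuous_fderiv (by simp))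

theorem norm_gradient_eq (f : E → ℝ) (x : E) : ‖∇ f x‖ = ‖fderiv ℝ f x‖ := by
  rw [← toDual_gradient, LinearIsometryEquiv.norm_map]

theorem enorm_gradient_eq (f : E → ℝ) (x : E) : ‖∇ f x‖ₑ = ‖fderiv ℝ f x‖ₑ := by
  rw [← ofReal_norm, ← ofReal_norm, norm_gradient_eq]

end Calculus

/-- `h` need not be uniformly continuous on ℝ, but w is bounded on K, and the approximants
eventually take values in the same ball enlarged by 1, where compactness applies. -/
theorem TendstoUniformlyOn.continuous_comp {E : Type*} [TopologicalSpace E] {K : Set E}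
    (hK : IsCompact K) {W : ℕ → E → ℝ} {w : E → ℝ} (hw : ContinuousOn w K)
    (hW : TendstoUniformlyOn W w atTop K) {h : ℝ → ℝ} (hh : Continuous h) :
    TendstoUniformlyOn (fun n x => h (W n x)) (fun x => h (w x)) atTop K := by
  obtain ⟨R, hR⟩ := (hK.image_of_continuousOn hw).isBounded.subset_closedBall 0
  have hu : UniformContinuousOn h (closedBall 0 (R + 1)) :=
    (isCompact_closedBall _ _).uniformContinuousOn_of_continuous hh.continuousOn
  have hwR : ∀ x ∈ K, |w x| ≤ R := fun x hx => by
    simpa using hR (mem_image_of_mem w hx)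
  rw [Metric.tendstoUniformlyOn_iff] at hW ⊢
  intro ε hε
  obtain ⟨δ, hδ, hd⟩ := Metric.uniformContinuousOn_iff.1 hu ε hε
  filter_upwards [hW (min δ 1) (by positivity)] with n hn x hx
  have h1 := hn x hx
  have h2 : |w x - W n x| < 1 := lt_of_lt_of_le h1 (min_le_right _ _)
  have h3 := hwR x hx
  refine hd _ ?_ _ ?_ (lt_of_lt_of_le h1 (min_le_left _ _))
  · rw [mem_closedBall_zero_iff, Real.norm_eq_abs]; linarith
  · rw [mem_closedBall_zero_iff, Real.norm_eq_abs]
    rw [abs_le] at h3 ⊢; rw [abs_lt] at h2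
    constructor <;> linarith

theorem tendsto_eLpNorm_smul_of_tendstoUniformlyOn {α F : Type*} [MeasurableSpace α]
    {μ : Measure α} [NormedAddCommGroup F] [NormedSpace ℝ F] {K : Set α} (hK : MeasurableSet K)
    {a : ℕ → α → ℝ} (ha : TendstoUniformlyOn a 0 atTop K) {X : α → F}
    (hX : MemLp X 2 (μ.restrict K)) :
    Tendsto (fun n => eLpNorm (fun x => a n x • X x) 2 (μ.restrict K)) atTop (𝓝 0) := by
  rw [ENNReal.tendsto_nhds_zero]
  intro ε hε
  obtain ⟨c, hc, hcε⟩ := ENNReal.exists_nnreal_pos_mul_lt hX.2.ne hε.ne'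
  filter_upwards [Metric.tendstoUniformlyOn_iff.1 ha c (by exact_mod_cast hc)] with n hn
  refine le_trans (eLpNorm_le_nnreal_smul_eLpNorm_of_ae_le_mul (c := c) ?_ 2) hcε.le
  filter_upwards [ae_restrict_mem hK] with x hx
  rw [nnnorm_smul]
  gcongr
  have := hn x hx
  simp only [Pi.zero_apply, dist_zero_left] at this
  exact_mod_cast this.le

/-! ### Product and chain rule for η h(w) -/

section Approximation

variable {E : Type*} [NormedAddCommGroup E] [InnerProductSpace ℝ E] [FiniteDimensional ℝ E]
  [MeasurableSpace E] [BorelSpace E] {D : Opens E} {w : E → ℝ} {G : E → E}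

theorem HasC1Approx.memLp_gradient_mul_comp (hA : HasC1Approx D w G) {η : E → ℝ}
    (hη : ContDiff ℝ 1 η) (hηc : HasCompactSupport η) (hηD : tsupport η ⊆ D) {h h' : ℝ → ℝ}
    (hh : Continuous h) (hh' : Continuous h') :
    MemLp (fun x => h (w x) • ∇ η x + (η x * h' (w x)) • G x) 2 volume := by
  have hK : IsCompact (tsupport η) := hηc
  have hwK := hA.continuousOn.mono hηD
  have hsupp : (fun x => h (w x) • ∇ η x + (η x * h' (w x)) • G x).support ⊆ tsupport η := by
    intro x hx
    by_contra hxK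
    refine hx ?_
    have h1 : η x = 0 := image_eq_zero_of_notMem_tsupport hxK
    have h2 : ∇ η x = 0 := image_eq_zero_of_notMem_tsupport
      fun h => hxK (tsupport_gradient_subset η h)
    simp [h1, h2]
  rw [← indicator_eq_self.2 hsupp, memLp_indicator_iff_restrict hK.measurableSet]
  have : IsFiniteMeasure (volume.restrict (tsupport η)) := ⟨by simpa using hK.measure_lt_top⟩
  have bdd : ∀ f : E → ℝ, ContinuousOn f (tsupport η) →
      ∃ C, ∀ᵐ x ∂(volume.restrict (tsupport η)), ‖f x‖ ≤ C := by
    intro f hf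
    obtain ⟨C, hC⟩ := hK.exists_bound_of_continuousOn hf
    exact ⟨C, (ae_restrict_mem hK.measurableSet).mono fun x hx => hC x hx⟩
  have c1 : ContinuousOn (fun x => h (w x)) (tsupport η) := hh.comp_continuousOn hwK
  have c2 : ContinuousOn (fun x => η x * h' (w x)) (tsupport η) :=
    hη.continuous.continuousOn.mul (hh'.comp_continuousOn hwK)
  refine MemLp.add ?_ ?_
  · have c3 : ContinuousOn (fun x => h (w x) • ∇ η x) (tsupport η) :=
      c1.smul hη.continuous_gradient.continuousOn
    obtain ⟨C, hC⟩ := hK.exists_bound_of_continuousOn c3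
    exact MemLp.of_bound (c3.aestronglyMeasurable hK.measurableSet) C
      ((ae_restrict_mem hK.measurableSet).mono fun x hx => hC x hx)
  · obtain ⟨C, hC⟩ := bdd _ c2
    refine MemLp.of_le_mul (c := C) (hA.memL2Loc_grad _ hK hηD)
      ((c2.aestronglyMeasurable hK.measurableSet).smul (hA.memL2Loc_grad _ hK hηD).1) ?_
    filter_upwards [hC] with x hx
    rw [norm_smul]
    gcongr

/-- The sequence is η h(W n), with W n the C¹ approximants of w on the support of η. Keeping the
sign and the support of η makes its terms usable as test functions. -/
theorem HasC1Approx.exists_seq_mul_comp (hA : HasC1Approx D w G) {η : E → ℝ}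
    (hη : ContDiff ℝ 1 η) (hηc : HasCompactSupport η) (hηD : tsupport η ⊆ D) {h h' : ℝ → ℝ}
    (hh : ∀ s, HasDerivAt h (h' s) s) (hh' : Continuous h') :
    ∃ u : ℕ → E → ℝ, (∀ n, ContDiff ℝ 1 (u n)) ∧ (∀ n, tsupport (u n) ⊆ tsupport η) ∧
      ((∀ x, 0 ≤ η x) → (∀ s, 0 ≤ h s) → ∀ n x, 0 ≤ u n x) ∧
      TendstoUniformly u (fun x => η x * h (w x)) atTop ∧
      Tendsto (fun n => eLpNorm (fun x => ∇ (u n) x -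
        (h (w x) • ∇ η x + (η x * h' (w x)) • G x)) 2 volume) atTop (𝓝 0) := by
  have hK : IsCompact (tsupport η) := hηc
  have hKm := hK.measurableSet
  have hwK := hA.continuousOn.mono hηD
  obtain ⟨W, hW1, hWu, hWg⟩ := hA.exists_seq _ hK hηD
  have hhc : Continuous h := continuous_iff_continuousAt.2 fun s => (hh s).continuousAt
  have hh1 : ContDiff ℝ 1 h := by
    rw [contDiff_one_iff_deriv]
    refine ⟨fun s => (hh s).differentiableAt, ?_⟩
    rwa [show deriv h = h' from funext fun s => (hh s).deriv]
  have ua := TendstoUniformlyOn.continuous_comp hK hwK hWu hhc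
  have ub := TendstoUniformlyOn.continuous_comp hK hwK hWu hh'
  obtain ⟨C, hC⟩ := hη.continuous.bounded_above_of_compact_support hηc
  have hC0 : 0 ≤ C := (norm_nonneg _).trans (hC 0)
  have hts : ∀ n, tsupport (fun x => η x * h (W n x)) ⊆ tsupport η :=
    fun n => tsupport_mul_subset_left
  have hgrad : ∀ n x, ∇ (fun x => η x * h (W n x)) x =
      h (W n x) • ∇ η x + (η x * h' (W n x)) • ∇ (W n) x := fun n x =>
    gradient_mul_comp (hη.differentiable (by simp) x) ((hW1 n).differentiable (by simp) x) (hh _)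
  refine ⟨fun n x => η x * h (W n x), fun n => hη.mul (hh1.comp (hW1 n)), hts,
    fun h1 h2 n x => mul_nonneg (h1 x) (h2 _), ?_, ?_⟩
  · rw [Metric.tendstoUniformly_iff]
    intro ε hε
    filter_upwards [Metric.tendstoUniformlyOn_iff.1 ua (ε / (C + 1)) (by positivity)] with n hn x
    by_cases hx : x ∈ tsupport η
    · have h1 := hn x hx
      rw [Real.dist_eq] at h1 ⊢
      rw [← mul_sub, abs_mul]
      have h2 : |η x| ≤ C := hC x
      calc |η x| * |h (w x) - h (W n x)| ≤ C * (ε / (C + 1)) := by gcongr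
        _ < ε := by
          rw [mul_div_assoc', div_lt_iff₀ (by positivity)]
          nlinarith
    · simp [image_eq_zero_of_notMem_tsupport hx, hε]
  · have hsupp : ∀ n, (fun x => ∇ (fun x => η x * h (W n x)) x -
        (h (w x) • ∇ η x + (η x * h' (w x)) • G x)).support ⊆ tsupport η := by
      intro n x hx
      by_contra hxK
      refine hx ?_
      have h1 : η x = 0 := image_eq_zero_of_notMem_tsupport hxK
      have h2 : ∇ η x = 0 := image_eq_zero_of_notMem_tsupport
        fun h => hxK (tsupport_gradient_subset η h)
      simp [h1, h2, hgrad]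
    simp only [fun n => (eLpNorm_restrict_eq_of_support_subset (p := 2)
      (μ := (volume : Measure E)) (hsupp n)).symm]
    have : IsFiniteMeasure (volume.restrict (tsupport η)) := ⟨by simpa using hK.measure_lt_top⟩
    have hGK := hA.memL2Loc_grad _ hK hηD
    have X1 : MemLp (∇ η) 2 (volume.restrict (tsupport η)) :=
      (hη.continuous_gradient.memLp_of_hasCompactSupport
        (hK.of_isClosed_subset (isClosed_tsupport _) (tsupport_gradient_subset η))).restrict _
    have X2 : MemLp (fun x => η x • G x) 2 (volume.restrict (tsupport η)) := by
      refine MemLp.of_le_mul (c := C) hGK (hη.continuous.aestronglyMeasurable.smul hGK.1)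
        (ae_of_all _ fun x => ?_)
      rw [norm_smul]
      gcongr
      exact hC x
    have zero : ∀ {f : ℕ → E → ℝ} {g : E → ℝ}, TendstoUniformlyOn f g atTop (tsupport η) →
        TendstoUniformlyOn (fun n x => f n x - g x) 0 atTop (tsupport η) := by
      intro f g hfg
      rw [Metric.tendstoUniformlyOn_iff] at hfg ⊢
      intro ε hε
      filter_upwards [hfg ε hε] with n hn x hx
      have := hn x hx
      rw [Real.dist_eq, abs_sub_comm] at this
      rwa [Pi.zero_apply, dist_zero_left, Real.norm_eq_abs]
    have T1 := tendsto_eLpNorm_smul_of_tendstoUniformlyOn hKm (zero ua) X1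
    have T2 := tendsto_eLpNorm_smul_of_tendstoUniformlyOn hKm (zero ub) X2
    obtain ⟨C2, hC2⟩ := hK.exists_bound_of_continuousOn (hh'.comp_continuousOn hwK)
    have T3 : Tendsto (fun n => eLpNorm (fun x => (η x * h' (W n x)) • (∇ (W n) x - G x)) 2
        (volume.restrict (tsupport η))) atTop (𝓝 0) := by
      have hlim : Tendsto (fun n => ENNReal.ofReal (C * (C2 + 1)) *
          eLpNorm (fun x => ∇ (W n) x - G x) 2 (volume.restrict (tsupport η))) atTop (𝓝 0) := by
        simpa using ENNReal.Tendsto.const_mul hWg (Or.inr ENNReal.ofReal_ne_top)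
      refine tendsto_of_tendsto_of_tendsto_of_le_of_le' tendsto_const_nhds hlim
        (Eventually.of_forall fun _ => bot_le) ?_
      filter_upwards [Metric.tendstoUniformlyOn_iff.1 ub 1 one_pos] with n hn
      refine eLpNorm_le_mul_eLpNorm_of_ae_le_mul ?_ 2
      filter_upwards [ae_restrict_mem hKm] with x hx
      have h1 := hn x hx
      have h2 := hC2 x hx
      rw [Real.dist_eq, abs_lt] at h1
      have h3 : ‖h' (W n x)‖ ≤ C2 + 1 := by
        simp only [Function.comp_apply, Real.norm_eq_abs, abs_le] at h2 ⊢
        constructor <;> linarith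
      rw [norm_smul, norm_mul]
      gcongr
      exact hC x
    -- The gradient error is (h(W n) - h(w)) ∇η + η h'(W n) (∇W n - G) + (h'(W n) - h'(w)) η G. The
    -- outer terms vanish by uniform convergence, the middle one because h'(W n) stays bounded.
    have T := (T1.add T3).add T2
    simp only [add_zero] at T
    refine tendsto_of_tendsto_of_tendsto_of_le_of_le tendsto_const_nhds T (fun _ => bot_le)
      fun n => ?_
    have m1 : AEStronglyMeasurable (fun x => (h (W n x) - h (w x)) • ∇ η x)
        (volume.restrict (tsupport η)) :=
      ((((hhc.comp (hW1 n).continuous).continuousOn.sub (hhc.comp_continuousOn hwK)).smul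
        hη.continuous_gradient.continuousOn)).aestronglyMeasurable hKm
    have m2 : AEStronglyMeasurable (fun x => (η x * h' (W n x)) • (∇ (W n) x - G x))
        (volume.restrict (tsupport η)) :=
      (hη.continuous.mul (hh'.comp (hW1 n).continuous)).aestronglyMeasurable.smul
        ((hW1 n).continuous_gradient.aestronglyMeasurable.sub hGK.1)
    have m3 : AEStronglyMeasurable (fun x => (h' (W n x) - h' (w x)) • (η x • G x))
        (volume.restrict (tsupport η)) :=
      (((hh'.comp (hW1 n).continuous).continuousOn.sub
        (hh'.comp_continuousOn hwK)).aestronglyMeasurable hKm).smul X2.1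
    refine le_trans (le_of_eq ?_) ((eLpNorm_add_le (m1.add m2) m3 (by norm_num)).trans
      (add_le_add_left (eLpNorm_add_le m1 m2 (by norm_num)) _))
    congr 1
    ext1 x
    simp only [hgrad, Pi.add_apply, smul_smul]
    module

end Approximation

/-! ### Enlarging the class of test functions by limits in L² -/

theorem tendsto_integral_inner_of_tendsto_eLpNorm {α F : Type*} [MeasurableSpace α] {ν : Measure α}
    [NormedAddCommGroup F] [InnerProductSpace ℝ F] {A X₀ : α → F} {X : ℕ → α → F}
    (hA : MemLp A 2 ν) (hX : ∀ n, MemLp (X n) 2 ν) (hX₀ : MemLp X₀ 2 ν)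
    (hlim : Tendsto (fun n => eLpNorm (fun x => X n x - X₀ x) 2 ν) atTop (𝓝 0)) :
    Tendsto (fun n => ∫ x, inner ℝ (A x) (X n x) ∂ν) atTop (𝓝 (∫ x, inner ℝ (A x) (X₀ x) ∂ν)) := by
  have h2 : Fact ((1 : ℝ≥0∞) ≤ 2) := ⟨by norm_num⟩
  have key : ∀ {Y : α → F} (hY : MemLp Y 2 ν),
      inner ℝ (hA.toLp A) (hY.toLp Y) = ∫ x, inner ℝ (A x) (Y x) ∂ν := by
    intro Y hY
    rw [L2.inner_def]
    refine integral_congr_ae ?_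
    filter_upwards [hA.coeFn_toLp, hY.coeFn_toLp] with x h1 h2
    rw [h1, h2]
  have hL : Tendsto (fun n => (hX n).toLp (X n)) atTop (𝓝 (hX₀.toLp X₀)) := by
    rw [Lp.tendsto_Lp_iff_tendsto_eLpNorm'']
    exact hlim
  have := (tendsto_const_nhds (x := hA.toLp A)).inner (𝕜 := ℝ) hL
  simpa only [key] using this

theorem MeasureTheory.MemLp.integrable_inner_of_two {α F : Type*} [MeasurableSpace α]
    {ν : Measure α} [NormedAddCommGroup F] [InnerProductSpace ℝ F] {A X : α → F}
    (hA : MemLp A 2 ν) (hX : MemLp X 2 ν) : Integrable (fun x => inner ℝ (A x) (X x)) ν := by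
  refine (L2.integrable_inner (𝕜 := ℝ) (hA.toLp A) (hX.toLp X)).congr ?_
  filter_upwards [hA.coeFn_toLp, hX.coeFn_toLp] with x h1 h2
  rw [h1, h2]

theorem tendsto_eLpNorm_restrict {α F : Type*} [MeasurableSpace α] {ν : Measure α}
    [NormedAddCommGroup F] {p : ℝ≥0∞} {f : ℕ → α → F} {K : Set α}
    (hf : Tendsto (fun n => eLpNorm (f n) p ν) atTop (𝓝 0)) :
    Tendsto (fun n => eLpNorm (f n) p (ν.restrict K)) atTop (𝓝 0) :=
  tendsto_of_tendsto_of_tendsto_of_le_of_le tendsto_const_nhds hf (fun _ => bot_le)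
    fun _ => eLpNorm_mono_measure _ Measure.restrict_le_self

theorem hasCompactSupport_gradient {E : Type*} [NormedAddCommGroup E] [InnerProductSpace ℝ E]
    [CompleteSpace E] {f : E → ℝ} (hf : HasCompactSupport f) : HasCompactSupport (∇ f) :=
  hf.isCompact.of_isClosed_subset (isClosed_tsupport _) (tsupport_gradient_subset f)

section WeakInequality

variable {E : Type*} [NormedAddCommGroup E] [InnerProductSpace ℝ E] [FiniteDimensional ℝ E]
  [MeasurableSpace E] [BorelSpace E] {D : Opens E} {w : E → ℝ} {G : E → E} {σ : E → ℝ} {M lam : ℝ}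

theorem memLp_smul_of_bounded (hσ : AEMeasurable σ (volume.restrict (D : Set E)))
    (hσM : ∀ x ∈ D, |σ x| ≤ M) (hG : MemL2Loc D G) {K : Set E} (hK : IsCompact K)
    (hKD : K ⊆ D) : MemLp (fun x => σ x • G x) 2 (volume.restrict K) := by
  refine MemLp.of_le_mul (c := M) (hG K hK hKD)
    ((hσ.mono_measure (Measure.restrict_mono hKD le_rfl)).aestronglyMeasurable.smul
      (hG K hK hKD).1) ?_
  filter_upwards [ae_restrict_mem hK.measurableSet] with x hx
  rw [norm_smul]
  gcongr
  exact hσM x (hKD hx)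

theorem memLp_const_mul_of_continuousOn (hw : ContinuousOn w D) {K : Set E} (hK : IsCompact K)
    (hKD : K ⊆ D) : MemLp (fun x => lam * w x) 2 (volume.restrict K) := by
  have : IsFiniteMeasure (volume.restrict K) := ⟨by simpa using hK.measure_lt_top⟩
  have hc : ContinuousOn (fun x => lam * w x) K := continuousOn_const.mul (hw.mono hKD)
  obtain ⟨C, hC⟩ := hK.exists_bound_of_continuousOn hc
  exact MemLp.of_bound (hc.aestronglyMeasurable hK.measurableSet) C
    ((ae_restrict_mem hK.measurableSet).mono fun x hx => hC x hx)

theorem integrableOn_weak_form (hσ : AEMeasurable σ (volume.restrict (D : Set E)))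
    (hσM : ∀ x ∈ D, |σ x| ≤ M) (hw : ContinuousOn w D) (hG : MemL2Loc D G) {K : Set E}
    (hK : IsCompact K) (hKD : K ⊆ D) {φ : E → ℝ} {X : E → E} (hφ : MemLp φ 2 volume)
    (hX : MemLp X 2 volume) :
    IntegrableOn (fun x => σ x * inner ℝ (G x) (X x) + lam * w x * φ x) K volume := by
  have h1 := (memLp_smul_of_bounded hσ hσM hG hK hKD).integrable_inner_of_two (hX.restrict K)
  have h2 := (memLp_const_mul_of_continuousOn (lam := lam) hw hK hKD).integrable_mul
    (hφ.restrict K)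
  refine (h1.add h2).congr (ae_of_all _ fun x => ?_)
  simp [real_inner_smul_left]

/-- With all supports in one compact K ⊆ D, the weak form is the sum of L² pairings on K with the
fixed functions σG and lam w, hence continuous in (φ, X). -/
theorem tendsto_weak_form (hσ : AEMeasurable σ (volume.restrict (D : Set E)))
    (hσM : ∀ x ∈ D, |σ x| ≤ M) (hw : ContinuousOn w D) (hG : MemL2Loc D G) {K : Set E}
    (hK : IsCompact K) (hKD : K ⊆ D) {φ : ℕ → E → ℝ} {X : ℕ → E → E} {φ₀ : E → ℝ} {X₀ : E → E}
    (hφ : ∀ n, MemLp (φ n) 2 volume) (hX : ∀ n, MemLp (X n) 2 volume) (hφ₀ : MemLp φ₀ 2 volume)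
    (hX₀ : MemLp X₀ 2 volume) (hs : ∀ n, ∀ x ∉ K, φ n x = 0 ∧ X n x = 0)
    (hs₀ : ∀ x ∉ K, φ₀ x = 0 ∧ X₀ x = 0)
    (hφl : Tendsto (fun n => eLpNorm (fun x => φ n x - φ₀ x) 2 volume) atTop (𝓝 0))
    (hXl : Tendsto (fun n => eLpNorm (fun x => X n x - X₀ x) 2 volume) atTop (𝓝 0)) :
    Tendsto (fun n => ∫ x in (D : Set E), (σ x * inner ℝ (G x) (X n x) + lam * w x * φ n x)) atTop
      (𝓝 (∫ x in (D : Set E), (σ x * inner ℝ (G x) (X₀ x) + lam * w x * φ₀ x))) := by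
  have hA := memLp_smul_of_bounded hσ hσM hG hK hKD
  have hb := memLp_const_mul_of_continuousOn (lam := lam) hw hK hKD
  have red : ∀ {ψ : E → ℝ} {Y : E → E}, (∀ x ∉ K, ψ x = 0 ∧ Y x = 0) → MemLp ψ 2 volume →
      MemLp Y 2 volume →
      ∫ x in (D : Set E), (σ x * inner ℝ (G x) (Y x) + lam * w x * ψ x) =
        (∫ x in K, inner ℝ (σ x • G x) (Y x)) + ∫ x in K, inner ℝ (lam * w x) (ψ x) := by
    intro ψ Y h0 hψ hY
    rw [← integral_add (hA.integrable_inner_of_two (hY.restrict K))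
      (hb.integrable_inner_of_two (hψ.restrict K)),
      ← setIntegral_eq_of_subset_of_forall_sdiff_eq_zero D.isOpen.measurableSet hKD]
    · refine integral_congr_ae (ae_of_all _ fun x => ?_)
      simp only [real_inner_smul_left, RCLike.inner_apply, conj_trivial]
      ring
    · intro x hx
      simp [(h0 x hx.2).1, (h0 x hx.2).2]
  rw [red hs₀ hφ₀ hX₀]
  simp only [fun n => red (hs n) (hφ n) (hX n)]
  exact (tendsto_integral_inner_of_tendsto_eLpNorm hA (fun n => (hX n).restrict K)
    (hX₀.restrict K) (tendsto_eLpNorm_restrict hXl)).add (tendsto_integral_inner_of_tendsto_eLpNorm hb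
      (fun n => (hφ n).restrict K) (hφ₀.restrict K) (tendsto_eLpNorm_restrict hφl))

theorem gradient_convolution_right {ρ f : E → ℝ} (hρ : LocallyIntegrable ρ volume)
    (hf : ContDiff ℝ 1 f) (hfc : HasCompactSupport f) (x : E) :
    ∇ (ρ ⋆[ContinuousLinearMap.lsmul ℝ ℝ, volume] f) x =
      (ρ ⋆[ContinuousLinearMap.lsmul ℝ ℝ, volume] ∇ f) x := by
  have hint : Integrable (fun t => ρ t • ∇ f (x - t)) volume :=
    (hasCompactSupport_gradient hfc).convolutionExists_right (ContinuousLinearMap.lsmul ℝ ℝ) hρ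
      hf.continuous_gradient x
  refine ext_inner_right ℝ fun v => ?_
  rw [inner_gradient_left, (hfc.hasFDerivAt_convolution_right (ContinuousLinearMap.lsmul ℝ ℝ) hρ hf
    x).fderiv, convolution_precompR_apply _ hρ (hfc.fderiv ℝ) (hf.continuous_fderiv (by simp)),
    convolution_def, convolution_def, real_inner_comm]
  refine Eq.trans ?_ (integral_inner hint v)
  refine integral_congr_ae (ae_of_all _ fun t => ?_)
  simp [real_inner_smul_right, inner_gradient_right]

/-- A weak inequality that holds for smooth test functions holds for `C¹` test functions. -/
theorem weak_form_nonneg_of_contDiff_one (hσ : AEMeasurable σ (volume.restrict (D : Set E)))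
    (hσM : ∀ x ∈ D, |σ x| ≤ M) (hw : ContinuousOn w D) (hG : MemL2Loc D G)
    (hweak : ∀ φ : 𝓓(D, ℝ), (∀ x, 0 ≤ φ x) →
      0 ≤ ∫ x in (D : Set E), (σ x * inner ℝ (G x) (∇ φ x) + lam * w x * φ x))
    {φ : E → ℝ} (hφ : ContDiff ℝ 1 φ) (hφc : HasCompactSupport φ) (hφD : tsupport φ ⊆ D)
    (hφ0 : ∀ x, 0 ≤ φ x) :
    0 ≤ ∫ x in (D : Set E), (σ x * inner ℝ (G x) (∇ φ x) + lam * w x * φ x) := by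
  -- Room of width r around the support of φ keeps the supports of its mollifications in one compact
  -- subset of D.
  obtain ⟨r, hr, hrD⟩ := hφc.isCompact.exists_cthickening_subset_open D.isOpen hφD
  set K := cthickening r (tsupport φ) with hKdef
  have hK : IsCompact K := hφc.isCompact.cthickening
  obtain ⟨ρ, hρr, hρ⟩ := exists_seq_contDiffBump_rOut_lt E hr
  set u : ℕ → E → ℝ := fun n =>
    (ρ n).normed volume ⋆[ContinuousLinearMap.lsmul ℝ ℝ, volume] φ with hu
  have hρi : ∀ n, LocallyIntegrable ((ρ n).normed volume) volume := fun n =>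
    (ρ n).integrable_normed.locallyIntegrable
  have husm : ∀ n, ContDiff ℝ ∞ (u n) := fun n =>
    (ρ n).hasCompactSupport_normed.contDiff_convolution_left (n := ⊤) _ (ρ n).contDiff_normed
      hφ.continuous.locallyIntegrable
  have husupp : ∀ n, tsupport (u n) ⊆ K := by
    intro n
    refine closure_minimal ((support_convolution_subset _).trans ?_) isClosed_cthickening
    rintro _ ⟨a, ha, b, hb, rfl⟩
    rw [(ρ n).support_normed_eq] at ha
    refine closedBall_subset_cthickening (subset_tsupport φ hb) r ?_
    rw [mem_closedBall, dist_eq_norm, add_sub_cancel_right]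
    exact (mem_ball_zero_iff.1 ha).le.trans (hρr n).le
  have huc : ∀ n, HasCompactSupport (u n) := fun n =>
    hK.of_isClosed_subset (isClosed_tsupport _) (husupp n)
  have hu0 : ∀ n x, 0 ≤ u n x := fun n x =>
    integral_nonneg fun t => mul_nonneg ((ρ n).nonneg_normed t) (hφ0 _)
  have hgrad : ∀ n, ∇ (u n) = (ρ n).normed volume ⋆[ContinuousLinearMap.lsmul ℝ ℝ, volume] ∇ φ :=
    fun n => funext fun x => gradient_convolution_right (hρi n) hφ hφc x
  have hφ2 : MemLp φ 2 volume := hφ.continuous.memLp_of_hasCompactSupport hφc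
  have hX2 : MemLp (∇ φ) 2 volume :=
    hφ.continuous_gradient.memLp_of_hasCompactSupport (hasCompactSupport_gradient hφc)
  have vanish : ∀ {f : E → ℝ}, tsupport f ⊆ K → ∀ x ∉ K, f x = 0 ∧ ∇ f x = 0 := fun hf x hx =>
    ⟨image_eq_zero_of_notMem_tsupport fun h => hx (hf h), image_eq_zero_of_notMem_tsupport
      fun h => hx (hf (tsupport_gradient_subset _ h))⟩
  have hun1 : ∀ n, ContDiff ℝ 1 (u n) := fun n => (husm n).of_le (by simp)
  have hlim := tendsto_weak_form (lam := lam) hσ hσM hw hG hK hrD (φ := u) (X := fun n => ∇ (u n))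
    (φ₀ := φ) (X₀ := ∇ φ)
    (fun n => (husm n).continuous.memLp_of_hasCompactSupport (huc n))
    (fun n => (hun1 n).continuous_gradient.memLp_of_hasCompactSupport
      (hasCompactSupport_gradient (huc n)))
    hφ2 hX2 (fun n => vanish (husupp n)) (vanish (self_subset_cthickening _))
    (tendsto_eLpNorm_convolution_sub hρ hφ2)
    (by simpa only [hgrad] using tendsto_eLpNorm_convolution_sub hρ hX2)
  refine ge_of_tendsto' hlim fun n => ?_
  exact hweak ⟨u n, husm n, huc n, (husupp n).trans hrD⟩ (hu0 n)

/-- The weak inequality tested with `η h(w)`. -/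
theorem HasC1Approx.weak_form_mul_comp_nonneg (hA : HasC1Approx D w G)
    (hσ : AEMeasurable σ (volume.restrict (D : Set E))) (hσM : ∀ x ∈ D, |σ x| ≤ M)
    (hweak : ∀ φ : 𝓓(D, ℝ), (∀ x, 0 ≤ φ x) →
      0 ≤ ∫ x in (D : Set E), (σ x * inner ℝ (G x) (∇ φ x) + lam * w x * φ x))
    {η : E → ℝ} (hη : ContDiff ℝ 1 η) (hηc : HasCompactSupport η) (hηD : tsupport η ⊆ D)
    (hη0 : ∀ x, 0 ≤ η x) {h h' : ℝ → ℝ} (hh : ∀ s, HasDerivAt h (h' s) s) (hh' : Continuous h')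
    (hh0 : ∀ s, 0 ≤ h s) :
    0 ≤ ∫ x in (D : Set E), (σ x * inner ℝ (G x) (h (w x) • ∇ η x + (η x * h' (w x)) • G x) +
      lam * w x * (η x * h (w x))) := by
  obtain ⟨u, hu1, hus, hu0, huu, hug⟩ := hA.exists_seq_mul_comp hη hηc hηD hh hh'
  have hhc : Continuous h := continuous_iff_continuousAt.2 fun s => (hh s).continuousAt
  have hK : IsCompact (tsupport η) := hηc
  have hwK := hA.continuousOn.mono hηD
  have huc : ∀ n, HasCompactSupport (u n) := fun n =>
    hK.of_isClosed_subset (isClosed_tsupport _) (hus n)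
  have vanish : ∀ {f : E → ℝ}, tsupport f ⊆ tsupport η → ∀ x ∉ tsupport η, f x = 0 ∧ ∇ f x = 0 :=
    fun hf x hx => ⟨image_eq_zero_of_notMem_tsupport fun h => hx (hf h),
      image_eq_zero_of_notMem_tsupport fun h => hx (hf (tsupport_gradient_subset _ h))⟩
  have hu2 : ∀ n, MemLp (u n) 2 volume := fun n =>
    (hu1 n).continuous.memLp_of_hasCompactSupport (huc n)
  have hsupp : ∀ {f : E → ℝ}, (∀ x ∉ tsupport η, f x = 0) → f.support ⊆ tsupport η :=
    fun hf x hx => by_contra fun h => hx (hf x h)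
  have hf0 : ∀ x ∉ tsupport η, η x * h (w x) = 0 := fun x hx => by
    rw [image_eq_zero_of_notMem_tsupport hx, zero_mul]
  have : IsFiniteMeasure (volume.restrict (tsupport η)) := ⟨by simpa using hK.measure_lt_top⟩
  have hf2 : MemLp (fun x => η x * h (w x)) 2 volume := by
    rw [← indicator_eq_self.2 (hsupp hf0), memLp_indicator_iff_restrict hK.measurableSet]
    have hc : ContinuousOn (fun x => η x * h (w x)) (tsupport η) :=
      hη.continuous.continuousOn.mul (hhc.comp_continuousOn hwK)
    obtain ⟨C, hC⟩ := hK.exists_bound_of_continuousOn hc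
    exact MemLp.of_bound (hc.aestronglyMeasurable hK.measurableSet) C
      ((ae_restrict_mem hK.measurableSet).mono fun x hx => hC x hx)
  have hlim2 : Tendsto (fun n => eLpNorm (fun x => u n x - η x * h (w x)) 2 volume) atTop
      (𝓝 0) := by
    have hz : TendstoUniformlyOn (fun n x => u n x - η x * h (w x)) 0 atTop (tsupport η) := by
      rw [Metric.tendstoUniformly_iff] at huu
      rw [Metric.tendstoUniformlyOn_iff]
      intro ε hε
      filter_upwards [huu ε hε] with n hn x hx
      have := hn x
      rw [Real.dist_eq, abs_sub_comm] at this
      rwa [Pi.zero_apply, dist_zero_left, Real.norm_eq_abs]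
    have := tendsto_eLpNorm_smul_of_tendstoUniformlyOn (μ := (volume : Measure E))
      hK.measurableSet hz (X := fun _ => (1 : ℝ)) (memLp_const 1)
    refine this.congr fun n => ?_
    rw [eLpNorm_restrict_eq_of_support_subset]
    · simp
    · exact hsupp fun x hx => by rw [(vanish (hus n) x hx).1, hf0 x hx]; simp
  have hlim := tendsto_weak_form (lam := lam) hσ hσM hA.continuousOn hA.memL2Loc_grad hK hηD
    (φ := u) (X := fun n => ∇ (u n)) hu2
    (fun n => (hu1 n).continuous_gradient.memLp_of_hasCompactSupport
      (hasCompactSupport_gradient (huc n)))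
    hf2 (hA.memLp_gradient_mul_comp hη hηc hηD hhc hh') (fun n => vanish (hus n))
    (fun x hx => ⟨hf0 x hx, by
      rw [(vanish subset_rfl x hx).1, (vanish subset_rfl x hx).2]; simp⟩) hlim2 hug
  -- Each η h(W n) is a nonnegative C¹ test function, so the inequality survives in the limit.
  exact ge_of_tendsto' hlim fun n => weak_form_nonneg_of_contDiff_one hσ hσM hA.continuousOn
    hA.memL2Loc_grad hweak (hu1 n) (huc n) ((hus n).trans hηD) (hu0 hη0 hh0 n)

end WeakInequality

/-! ### Caccioppoli and Sobolev inequalities -/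

/-- An exponent of at least 2 removes the corner of the positive part: at 0 the function is bounded
by |t| ^ (m + 2) = o(t). -/
theorem hasDerivAt_max_zero_pow (m : ℕ) (t : ℝ) :
    HasDerivAt (fun t : ℝ => max t 0 ^ (m + 2)) ((m + 2) * max t 0 ^ (m + 1)) t := by
  rcases lt_trichotomy t 0 with ht | rfl | ht
  · have : (fun t : ℝ => max t 0 ^ (m + 2)) =ᶠ[𝓝 t] fun _ => 0 := by
      filter_upwards [gt_mem_nhds ht] with s hs
      simp [max_eq_right hs.le]
    simpa [max_eq_right ht.le] using (hasDerivAt_const t (0 : ℝ)).congr_of_eventuallyEq this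
  · have : HasDerivAt (fun t : ℝ => max t 0 ^ (m + 2)) 0 0 := by
      rw [hasDerivAt_iff_isLittleO]
      simp only [max_self, sub_zero, smul_zero, ne_eq, Nat.add_eq_zero_iff, OfNat.ofNat_ne_zero,
        and_false, not_false_eq_true, zero_pow]
      refine Asymptotics.IsBigO.trans_isLittleO (g := fun t : ℝ => t ^ (m + 2)) ?_
        (Asymptotics.isLittleO_pow_id (by omega))
      refine Asymptotics.IsBigO.of_bound 1 (Eventually.of_forall fun s => ?_)
      rw [one_mul, norm_pow, norm_pow]
      gcongr
      rw [Real.norm_eq_abs, Real.norm_eq_abs, abs_of_nonneg (le_max_right _ _)]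
      exact max_le (le_abs_self s) (abs_nonneg s)
    simpa using this
  · have : (fun t : ℝ => max t 0 ^ (m + 2)) =ᶠ[𝓝 t] fun t => t ^ (m + 2) := by
      filter_upwards [lt_mem_nhds ht] with s hs
      simp [max_eq_left hs.le]
    have h2 := (hasDerivAt_pow (m + 2) t).congr_of_eventuallyEq this
    rw [max_eq_left ht.le]
    rwa [Nat.cast_add, Nat.cast_ofNat] at h2

theorem hasDerivAt_max_sub_zero_pow (m : ℕ) (k s : ℝ) :
    HasDerivAt (fun s : ℝ => max (k - s) 0 ^ (m + 2)) (-((m + 2) * max (k - s) 0 ^ (m + 1))) s := by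
  have h1 := (hasDerivAt_max_zero_pow m (k - s)).comp s ((hasDerivAt_id s).const_sub k)
  rwa [mul_neg_one] at h1

section Supersolution

variable {E : Type*} [NormedAddCommGroup E] [InnerProductSpace ℝ E] [FiniteDimensional ℝ E]
  [MeasurableSpace E] [BorelSpace E]

/-- `w` is a continuous weak supersolution of `-div(σ∇w) + lam w ≥ 0` in `D` with weak gradient `G`,
where `μ ≤ σ ≤ M`. -/
structure IsEllipticSupersolution (D : Opens E) (σ : E → ℝ) (μ M lam : ℝ) (w : E → ℝ) (G : E → E) :
    Prop where
  hasC1Approx : HasC1Approx D w G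
  aemeasurable : AEMeasurable σ (volume.restrict (D : Set E))
  pos : 0 < μ
  bounds : ∀ x ∈ D, μ ≤ σ x ∧ σ x ≤ M
  lam_pos : 0 < lam
  weak : ∀ φ : 𝓓(D, ℝ), (∀ x, 0 ≤ φ x) →
    0 ≤ ∫ x in (D : Set E), (σ x * inner ℝ (G x) (∇ φ x) + lam * w x * φ x)

variable {D : Opens E} {w : E → ℝ} {G : E → E} {σ : E → ℝ} {μ M lam : ℝ}

theorem integrableOn_of_continuousOn_of_eq_zero {f : E → ℝ} (hf : ContinuousOn f D) {K : Set E}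
    (hK : IsCompact K) (hKD : K ⊆ D) (h0 : ∀ x ∉ K, f x = 0) :
    IntegrableOn f D volume :=
  ((hf.mono hKD).integrableOn_compact hK).of_forall_sdiff_eq_zero D.isOpen.measurableSet
    fun x hx => h0 x hx.2

theorem HasC1Approx.integrableOn_sq_mul_norm_sq (hA : HasC1Approx D w G) {η : E → ℝ}
    (hη : Continuous η) (hηc : HasCompactSupport η) (hηD : tsupport η ⊆ D) {g : ℝ → ℝ}
    (hg : Continuous g) :
    IntegrableOn (fun x => g (w x) * η x ^ 2 * ‖G x‖ ^ 2) D volume := by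
  have hK : IsCompact (tsupport η) := hηc
  have hGi : IntegrableOn (fun x => ‖G x‖ ^ 2) (tsupport η) volume :=
    (hA.memL2Loc_grad _ hK hηD).integrable_norm_pow (by norm_num)
  have hc : ContinuousOn (fun x => g (w x) * η x ^ 2) (tsupport η) :=
    (hg.comp_continuousOn (hA.continuousOn.mono hηD)).mul (hη.pow 2).continuousOn
  refine IntegrableOn.of_forall_sdiff_eq_zero (hGi.continuousOn_mul hc hK)
    D.isOpen.measurableSet fun x hx => ?_
  simp [image_eq_zero_of_notMem_tsupport hx.2]

theorem IsEllipticSupersolution.integrableOn_caccioppoli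
    (hS : IsEllipticSupersolution D σ μ M lam w G) (k : ℝ)
    {η : E → ℝ} (hη : ContDiff ℝ 1 η) (hηc : HasCompactSupport η) (hηD : tsupport η ⊆ D) :
    IntegrableOn (fun x => M * (max (k - w x) 0 ^ 4 * ‖∇ η x‖ ^ 2) +
      lam * (w x * max (k - w x) 0 ^ 3 * η x ^ 2)) D volume := by
  have hw := hS.hasC1Approx.continuousOn
  have hK : IsCompact (tsupport η) := hηc
  have hp : ContinuousOn (fun x => max (k - w x) 0) D :=
    ((continuousOn_const.sub hw).sup continuousOn_const)
  have hR1 : IntegrableOn (fun x => max (k - w x) 0 ^ 4 * ‖∇ η x‖ ^ 2) D volume := by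
    refine integrableOn_of_continuousOn_of_eq_zero
      ((hp.pow 4).mul (hη.continuous_gradient.norm.pow 2).continuousOn) hK hηD fun x hx => ?_
    have : ∇ η x = 0 := image_eq_zero_of_notMem_tsupport
      fun h => hx (tsupport_gradient_subset _ h)
    simp [this]
  have hR2 : IntegrableOn (fun x => w x * max (k - w x) 0 ^ 3 * η x ^ 2) D volume := by
    refine integrableOn_of_continuousOn_of_eq_zero
      ((hw.mul (hp.pow 3)).mul (hη.continuous.pow 2).continuousOn) hK hηD fun x hx => ?_
    simp [image_eq_zero_of_notMem_tsupport hx]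
  exact (hR1.const_mul M).add (hR2.const_mul lam)

/-- Obtained by testing with η² p³, where p = (k - w)₊. Differentiating p³ produces -3 σ p² η² |G|²,
and Young's inequality spends one of these three copies on the cross term, whence the factor 2. The
term in lam keeps its sign: it supplies decay for k < 0 and is a harmless error when w ≥ 0. -/
theorem IsEllipticSupersolution.caccioppoli (hS : IsEllipticSupersolution D σ μ M lam w G) (k : ℝ)
    {η : E → ℝ} (hη : ContDiff ℝ 1 η) (hηc : HasCompactSupport η) (hηD : tsupport η ⊆ D) :
    2 * μ * ∫ x in (D : Set E), max (k - w x) 0 ^ 2 * η x ^ 2 * ‖G x‖ ^ 2 ≤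
      ∫ x in (D : Set E), (M * (max (k - w x) 0 ^ 4 * ‖∇ η x‖ ^ 2) +
        lam * (w x * max (k - w x) 0 ^ 3 * η x ^ 2)) := by
  have hA := hS.hasC1Approx
  have hw := hA.continuousOn
  have hK : IsCompact (tsupport η) := hηc
  have hp : ContinuousOn (fun x => max (k - w x) 0) D :=
    ((continuousOn_const.sub hw).sup continuousOn_const)
  have hQ : IntegrableOn (fun x => max (k - w x) 0 ^ 2 * η x ^ 2 * ‖G x‖ ^ 2) D volume :=
    hA.integrableOn_sq_mul_norm_sq hη.continuous hηc hηD (g := fun s => max (k - s) 0 ^ 2)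
      (by fun_prop)
  have hη2 : ContDiff ℝ 1 fun x => η x ^ 2 := hη.pow 2
  have hsub : tsupport (fun x => η x ^ 2) ⊆ tsupport η := by
    refine closure_minimal (fun x hx => subset_tsupport η fun h => hx ?_) (isClosed_tsupport _)
    simp [h]
  have hη2c : HasCompactSupport fun x => η x ^ 2 :=
    hK.of_isClosed_subset (isClosed_tsupport _) hsub
  have hη2g : ∀ x, ∇ (fun x => η x ^ 2) x = (2 * η x) • ∇ η x := by
    intro x
    have h1 := gradient_mul_comp (η := η) (W := η) (h := id) (h' := fun _ => 1) (x := x)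
      (hη.differentiable (by simp) x) (hη.differentiable (by simp) x) (hasDerivAt_id _)
    simp only [id, mul_one, ← add_smul] at h1
    simp only [pow_two, h1, two_mul]
  have hσM : ∀ x ∈ D, |σ x| ≤ M := fun x hx => by
    rw [abs_of_nonneg (hS.pos.le.trans (hS.bounds x hx).1)]
    exact (hS.bounds x hx).2
  have hh : ∀ s, HasDerivAt (fun s : ℝ => max (k - s) 0 ^ 3)
      ((fun s : ℝ => -(3 * max (k - s) 0 ^ 2)) s) s := fun s => by
    have := hasDerivAt_max_sub_zero_pow 1 k s
    norm_num at this
    exact this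
  have hweak := hA.weak_form_mul_comp_nonneg hS.aemeasurable hσM hS.weak hη2 hη2c
    (hsub.trans hηD) (fun x => sq_nonneg _) hh (by fun_prop)
    (fun s => pow_nonneg (le_max_right _ _) 3)
  have hF := hA.memLp_gradient_mul_comp hη2 hη2c (hsub.trans hηD) (h := fun s => max (k - s) 0 ^ 3)
    (h' := fun s => -(3 * max (k - s) 0 ^ 2)) (by fun_prop) (by fun_prop)
  have hI : IntegrableOn (fun x => σ x * inner ℝ (G x) (max (k - w x) 0 ^ 3 •
      ∇ (fun x => η x ^ 2) x + (η x ^ 2 * -(3 * max (k - w x) 0 ^ 2)) • G x) +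
      lam * w x * (η x ^ 2 * max (k - w x) 0 ^ 3)) D volume := by
    have hφ2 : MemLp (fun x => (tsupport η).indicator
        (fun x => η x ^ 2 * max (k - w x) 0 ^ 3) x) 2 volume := by
      have : IsFiniteMeasure (volume.restrict (tsupport η)) := ⟨by simpa using hK.measure_lt_top⟩
      rw [memLp_indicator_iff_restrict hK.measurableSet]
      have hc : ContinuousOn (fun x => η x ^ 2 * max (k - w x) 0 ^ 3) (tsupport η) :=
        (hη.continuous.pow 2).continuousOn.mul ((hp.mono hηD).pow 3)
      obtain ⟨C, hC⟩ := hK.exists_bound_of_continuousOn hc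
      exact MemLp.of_bound (hc.aestronglyMeasurable hK.measurableSet) C
        ((ae_restrict_mem hK.measurableSet).mono fun x hx => hC x hx)
    have h1 := integrableOn_weak_form (lam := lam) hS.aemeasurable hσM hw hA.memL2Loc_grad hK hηD
      hφ2 hF
    refine IntegrableOn.of_forall_sdiff_eq_zero (s := tsupport η)
      (h1.congr_fun (fun x hx => ?_) hK.measurableSet) D.isOpen.measurableSet fun x hx => ?_
    · simp only [indicator_of_mem hx]
    · have h0 := image_eq_zero_of_notMem_tsupport hx.2
      simp [h0, hη2g]
  have hR := hS.integrableOn_caccioppoli k hη hηc hηD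
  have hmono : ∫ x in (D : Set E), (σ x * inner ℝ (G x) (max (k - w x) 0 ^ 3 •
      ∇ (fun x => η x ^ 2) x + (η x ^ 2 * -(3 * max (k - w x) 0 ^ 2)) • G x) +
      lam * w x * (η x ^ 2 * max (k - w x) 0 ^ 3)) ≤
      ∫ x in (D : Set E), ((M * (max (k - w x) 0 ^ 4 * ‖∇ η x‖ ^ 2) +
        lam * (w x * max (k - w x) 0 ^ 3 * η x ^ 2)) -
        2 * μ * (max (k - w x) 0 ^ 2 * η x ^ 2 * ‖G x‖ ^ 2)) := by
    refine setIntegral_mono_on hI (hR.sub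
      (hQ.const_mul (2 * μ))) D.isOpen.measurableSet fun x hx => ?_
    obtain ⟨hμ, hM⟩ := hS.bounds x hx
    have hσ0 : 0 ≤ σ x := hS.pos.le.trans hμ
    rw [hη2g, inner_add_right, real_inner_smul_right, real_inner_smul_right, real_inner_smul_right,
      real_inner_self_eq_norm_sq]
    set p := max (k - w x) 0
    have hp0 : 0 ≤ p := le_max_right _ _
    have hCS := abs_real_inner_le_norm (G x) (∇ η x)
    -- Young's inequality, from the square of p |η| |G| - p² |∇η|.
    have h1 : 2 * (p ^ 3 * (η x * inner ℝ (G x) (∇ η x))) ≤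
        p ^ 2 * η x ^ 2 * ‖G x‖ ^ 2 + p ^ 4 * ‖∇ η x‖ ^ 2 := by
      have h2 : η x * inner ℝ (G x) (∇ η x) ≤ |η x| * (‖G x‖ * ‖∇ η x‖) := by
        refine (le_abs_self _).trans ?_
        rw [abs_mul]
        gcongr
      have h3 : p ^ 3 * (η x * inner ℝ (G x) (∇ η x)) ≤ p ^ 3 * (|η x| * (‖G x‖ * ‖∇ η x‖)) := by
        gcongr
      have h4 := sq_nonneg (p * |η x| * ‖G x‖ - p ^ 2 * ‖∇ η x‖)
      have h5 : |η x| ^ 2 = η x ^ 2 := sq_abs _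
      calc 2 * (p ^ 3 * (η x * inner ℝ (G x) (∇ η x)))
          ≤ 2 * (p ^ 3 * (|η x| * (‖G x‖ * ‖∇ η x‖))) := by linarith
        _ ≤ p ^ 2 * |η x| ^ 2 * ‖G x‖ ^ 2 + p ^ 4 * ‖∇ η x‖ ^ 2 := by linarith
        _ = _ := by rw [h5]
    have h6 := mul_le_mul_of_nonneg_left h1 hσ0
    have hq : 0 ≤ p ^ 2 * η x ^ 2 * ‖G x‖ ^ 2 := by positivity
    have h7 : σ x * (p ^ 4 * ‖∇ η x‖ ^ 2) ≤ M * (p ^ 4 * ‖∇ η x‖ ^ 2) := by gcongr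
    have h8 : μ * (p ^ 2 * η x ^ 2 * ‖G x‖ ^ 2) ≤ σ x * (p ^ 2 * η x ^ 2 * ‖G x‖ ^ 2) := by gcongr
    linarith
  have hfin := hweak.trans hmono
  rw [integral_sub hR (hQ.const_mul (2 * μ)),
    integral_const_mul] at hfin
  linarith

/-- On the common compact support L² convergence of gradients implies L¹ convergence, the form
needed by the L¹ Sobolev and Poincaré inequalities. -/
theorem HasC1Approx.exists_seq_mul_comp_lintegral (hA : HasC1Approx D w G) {η : E → ℝ}
    (hη : ContDiff ℝ 1 η) (hηc : HasCompactSupport η) (hηD : tsupport η ⊆ D) {h h' : ℝ → ℝ}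
    (hh : ∀ s, HasDerivAt h (h' s) s) (hh' : Continuous h') :
    ∃ u : ℕ → E → ℝ, (∀ n, ContDiff ℝ 1 (u n)) ∧ (∀ n, HasCompactSupport (u n)) ∧
      TendstoUniformly u (fun x => η x * h (w x)) atTop ∧
      Tendsto (fun n => ∫⁻ x, ‖∇ (u n) x -
        (h (w x) • ∇ η x + (η x * h' (w x)) • G x)‖ₑ) atTop (𝓝 0) := by
  obtain ⟨u, hu1, hus, -, huu, hug⟩ := hA.exists_seq_mul_comp hη hηc hηD hh hh'
  have hK : IsCompact (tsupport η) := hηc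
  have hhc : Continuous h := continuous_iff_continuousAt.2 fun s => (hh s).continuousAt
  have hF := hA.memLp_gradient_mul_comp hη hηc hηD hhc hh'
  refine ⟨u, hu1, fun n => hK.of_isClosed_subset (isClosed_tsupport _) (hus n), huu, ?_⟩
  have hgz : ∀ {f : E → ℝ}, tsupport f ⊆ tsupport η → ∀ x ∉ tsupport η, ∇ f x = 0 :=
    fun hf x hx => image_eq_zero_of_notMem_tsupport
      fun h => hx (hf (tsupport_gradient_subset _ h))
  have hsupp : ∀ n, (fun x => ∇ (u n) x -
      (h (w x) • ∇ η x + (η x * h' (w x)) • G x)).support ⊆ tsupport η := by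
    intro n x hx
    by_contra hxK
    refine hx ?_
    simp [hgz (hus n) x hxK, hgz subset_rfl x hxK, image_eq_zero_of_notMem_tsupport hxK]
  have hlim := ENNReal.Tendsto.mul_const (b := volume (tsupport η) ^ (1 / (1 : ℝ) - 1 / 2))
    (tendsto_eLpNorm_restrict (K := tsupport η) hug)
    (Or.inr (ENNReal.rpow_ne_top_of_nonneg (by norm_num) hK.measure_lt_top.ne))
  rw [zero_mul] at hlim
  refine tendsto_of_tendsto_of_tendsto_of_le_of_le tendsto_const_nhds hlim (fun _ => bot_le)
    fun n => ?_
  have hm : AEStronglyMeasurable (fun x => ∇ (u n) x -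
      (h (w x) • ∇ η x + (η x * h' (w x)) • G x)) (volume.restrict (tsupport η)) :=
    ((hu1 n).continuous_gradient.aestronglyMeasurable.sub hF.1).restrict
  have := eLpNorm_le_eLpNorm_mul_rpow_measure_univ (p := 1) (q := 2) (by norm_num) hm
  rw [eLpNorm_restrict_eq_of_support_subset (p := 1) (hsupp n), eLpNorm_one_eq_lintegral_enorm]
    at this
  simpa using this

/-- The Gagliardo–Nirenberg–Sobolev inequality for `η h(w)`. -/
theorem HasC1Approx.lintegral_pow_le (hA : HasC1Approx D w G) {q : ℝ}
    (hq : Real.HolderConjugate (Module.finrank ℝ E) q) {η : E → ℝ}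
    (hη : ContDiff ℝ 1 η) (hηc : HasCompactSupport η) (hηD : tsupport η ⊆ D) {h h' : ℝ → ℝ}
    (hh : ∀ s, HasDerivAt h (h' s) s) (hh' : Continuous h') :
    ∫⁻ x, ‖η x * h (w x)‖ₑ ^ q ≤
      lintegralPowLePowLIntegralFDerivConst (volume : Measure E) q *
        (∫⁻ x, ‖h (w x) • ∇ η x + (η x * h' (w x)) • G x‖ₑ) ^ q := by
  obtain ⟨u, hu1, huc, huu, hug⟩ := hA.exists_seq_mul_comp_lintegral hη hηc hηD hh hh'
  set F : E → E := fun x => h (w x) • ∇ η x + (η x * h' (w x)) • G x with hFdef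
  set C := lintegralPowLePowLIntegralFDerivConst (volume : Measure E) q
  have hq0 : 0 < q := hq.symm.pos
  have hpt : ∀ x, Tendsto (fun n => ‖u n x‖ₑ ^ q) atTop (𝓝 (‖η x * h (w x)‖ₑ ^ q)) := fun x =>
    ((huu.tendsto_at x).enorm).ennrpow_const q
  have hb : ∀ n, ∫⁻ x, ‖u n x‖ₑ ^ q ≤
      C * ((∫⁻ x, ‖F x‖ₑ) + ∫⁻ x, ‖∇ (u n) x - F x‖ₑ) ^ q := by
    intro n
    refine (lintegral_pow_le_pow_lintegral_fderiv volume (hu1 n) (huc n) hq).trans ?_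
    gcongr
    have hm : AEMeasurable (fun x => ‖F x‖ₑ) volume :=
      (hA.memLp_gradient_mul_comp hη hηc hηD
        (continuous_iff_continuousAt.2 fun s => (hh s).continuousAt) hh').1.enorm
    rw [← lintegral_add_left' hm]
    refine lintegral_mono fun x => ?_
    rw [← enorm_gradient_eq]
    calc ‖∇ (u n) x‖ₑ = ‖F x + (∇ (u n) x - F x)‖ₑ := by rw [add_sub_cancel]
      _ ≤ _ := enorm_add_le _ _
  have hlim : Tendsto (fun n => C * ((∫⁻ x, ‖F x‖ₑ) + ∫⁻ x, ‖∇ (u n) x - F x‖ₑ) ^ q) atTop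
      (𝓝 (C * (∫⁻ x, ‖F x‖ₑ) ^ q)) := by
    refine ENNReal.Tendsto.const_mul ?_ (Or.inr ENNReal.coe_ne_top)
    have := ((tendsto_const_nhds (x := ∫⁻ x, ‖F x‖ₑ)).add hug).ennrpow_const q
    rwa [add_zero] at this
  -- Fatou's lemma on the left suffices, since the bounds on the right converge.
  calc ∫⁻ x, ‖η x * h (w x)‖ₑ ^ q
      = ∫⁻ x, liminf (fun n => ‖u n x‖ₑ ^ q) atTop :=
        lintegral_congr fun x => (hpt x).liminf_eq.symm
    _ ≤ liminf (fun n => ∫⁻ x, ‖u n x‖ₑ ^ q) atTop :=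
        lintegral_liminf_le fun n => ((hu1 n).continuous.measurable.enorm).pow_const q
    _ ≤ liminf (fun n => C * ((∫⁻ x, ‖F x‖ₑ) + ∫⁻ x, ‖∇ (u n) x - F x‖ₑ) ^ q) atTop :=
        liminf_le_liminf (Eventually.of_forall hb)
    _ = _ := hlim.liminf_eq

end Supersolution

/-! ### Cutoff functions -/

open scoped Manifold

theorem exists_deriv_smoothTransition_bound :
    ∃ C : ℝ, 0 < C ∧ ∀ t, |deriv Real.smoothTransition t| ≤ C := by
  have hc : Continuous (deriv Real.smoothTransition) :=
    (Real.smoothTransition.contDiff (n := 1)).continuous_deriv (by simp)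
  obtain ⟨C, hC⟩ := (isCompact_Icc (a := (0 : ℝ)) (b := 1)).exists_bound_of_continuousOn
    hc.continuousOn
  refine ⟨max C 1, by positivity, fun t => ?_⟩
  by_cases ht : t ∈ Icc (0 : ℝ) 1
  · exact (hC t ht).trans (le_max_left _ _)
  · have : deriv Real.smoothTransition t = 0 := by
      rcases lt_or_ge t 0 with h | h
      · have : Real.smoothTransition =ᶠ[𝓝 t] fun _ => 0 := by
          filter_upwards [gt_mem_nhds h] with s hs
          exact Real.smoothTransition.zero_of_nonpos hs.le
        rw [this.deriv_eq, deriv_const]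
      · have h1 : 1 < t := lt_of_not_ge fun h1 => ht ⟨h, h1⟩
        have : Real.smoothTransition =ᶠ[𝓝 t] fun _ => 1 := by
          filter_upwards [lt_mem_nhds h1] with s hs
          exact Real.smoothTransition.one_of_one_le hs.le
        rw [this.deriv_eq, deriv_const]
    rw [this, abs_zero]
    positivity

section Cutoff

/-- Cutoff functions between concentric balls with a gradient bound. -/
theorem exists_cutoff_ball (E : Type*) [NormedAddCommGroup E] [InnerProductSpace ℝ E]
    [CompleteSpace E] :
    ∃ C : ℝ, 0 < C ∧ ∀ (x₀ : E) (r R : ℝ), 0 ≤ r → r < R → ∃ ζ : E → ℝ, ContDiff ℝ 1 ζ ∧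
      (∀ x, 0 ≤ ζ x) ∧ (∀ x, ζ x ≤ 1) ∧ (∀ x ∈ closedBall x₀ r, ζ x = 1) ∧
      tsupport ζ ⊆ closedBall x₀ R ∧ ∀ x, ‖∇ ζ x‖ ≤ C / (R - r) := by
  obtain ⟨C, hC0, hC⟩ := exists_deriv_smoothTransition_bound
  refine ⟨2 * C, by positivity, fun x₀ r R hr hrR => ?_⟩
  have hd : 0 < R ^ 2 - r ^ 2 := by nlinarith
  -- W is at least 1 on the inner ball and at most 0 outside the outer one, and the squared norm
  -- keeps it smooth at the centre. Its gradient on the outer ball is at most 2R / (R² - r²) ≤ 2 /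
  -- (R - r).
  set W : E → ℝ := fun x => (R ^ 2 - r ^ 2)⁻¹ * (R ^ 2 - ‖x - x₀‖ ^ 2) with hW
  have hWd : ∀ x, HasFDerivAt W ((R ^ 2 - r ^ 2)⁻¹ • (-(2 • (innerSL ℝ (x - x₀)).comp
      (ContinuousLinearMap.id ℝ E)) : E →L[ℝ] ℝ)) x := fun x =>
    ((((hasFDerivAt_id x).sub_const x₀).norm_sq).const_sub (R ^ 2)).const_mul _
  have hs : tsupport (fun x => Real.smoothTransition (W x)) ⊆ closedBall x₀ R := by
    refine closure_minimal (fun x hx => ?_) isClosed_closedBall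
    by_contra h
    rw [mem_closedBall, not_le, dist_eq_norm] at h
    refine hx (Real.smoothTransition.zero_of_nonpos ?_)
    exact mul_nonpos_of_nonneg_of_nonpos (by positivity) (by nlinarith [norm_nonneg (x - x₀)])
  refine ⟨fun x => Real.smoothTransition (W x), ?_, fun x => Real.smoothTransition.nonneg _,
    fun x => Real.smoothTransition.le_one _, fun x hx => ?_, hs, fun x => ?_⟩
  · refine (Real.smoothTransition.contDiff (n := 1)).comp ?_
    exact contDiff_const.mul (contDiff_const.sub ((contDiff_id.sub contDiff_const).norm_sq ℝ))
  · refine Real.smoothTransition.one_of_one_le ?_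
    rw [mem_closedBall, dist_eq_norm] at hx
    rw [hW, le_inv_mul_iff₀ hd]
    nlinarith [norm_nonneg (x - x₀)]
  · by_cases hx : x ∈ closedBall x₀ R
    · rw [norm_gradient_eq]
      have hst : HasDerivAt Real.smoothTransition (deriv Real.smoothTransition (W x)) (W x) :=
        ((Real.smoothTransition.contDiff (n := 1)).differentiable (by simp) _).hasDerivAt
      have h1 : HasFDerivAt (fun x => Real.smoothTransition (W x)) _ x :=
        hst.comp_hasFDerivAt x (hWd x)
      rw [h1.fderiv, ContinuousLinearMap.comp_id, norm_smul, norm_smul, norm_neg,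
        two_smul, ← two_smul ℝ, norm_smul, innerSL_apply_norm, Real.norm_eq_abs, Real.norm_eq_abs,
        Real.norm_eq_abs, abs_of_pos (inv_pos.2 hd), abs_two]
      rw [mem_closedBall, dist_eq_norm] at hx
      have hR0 : 0 < R := hr.trans_lt hrR
      have hRr : 0 < R - r := sub_pos.2 hrR
      calc |deriv Real.smoothTransition (W x)| * ((R ^ 2 - r ^ 2)⁻¹ * (2 * ‖x - x₀‖))
          ≤ C * ((R ^ 2 - r ^ 2)⁻¹ * (2 * R)) := by
            gcongr
            exact hC _
        _ ≤ 2 * C / (R - r) := by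
            have : (R ^ 2 - r ^ 2)⁻¹ = (R - r)⁻¹ * (R + r)⁻¹ := by
              rw [← mul_inv]; congr 1; ring
            rw [this, div_eq_mul_inv]
            have h3 : (R + r)⁻¹ * R ≤ 1 := by
              rw [inv_mul_le_iff₀ (by linarith)]; linarith
            have h4 : 0 ≤ 2 * C * (R - r)⁻¹ := by positivity
            nlinarith [mul_le_mul_of_nonneg_left h3 h4]
    · have : ∇ (fun x => Real.smoothTransition (W x)) x = 0 :=
        image_eq_zero_of_notMem_tsupport fun h => hx (hs (tsupport_gradient_subset _ h))
      rw [this, norm_zero]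
      exact div_nonneg (by positivity) (sub_pos.2 hrR).le

/-- Being 1 near each point of K, and not only on K, lets χ drop out of gradients taken at points of
K. -/
theorem exists_cutoff_compact {E : Type*} [NormedAddCommGroup E] [InnerProductSpace ℝ E]
    [FiniteDimensional ℝ E] {K U : Set E} (hK : IsCompact K) (hU : IsOpen U) (hKU : K ⊆ U) :
    ∃ χ : E → ℝ, ContDiff ℝ 1 χ ∧ (∀ x ∈ K, χ =ᶠ[𝓝 x] fun _ => 1) ∧ HasCompactSupport χ ∧
      tsupport χ ⊆ U := by
  obtain ⟨L, hL, hKL, hLU⟩ := exists_compact_between hK hU hKU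
  obtain ⟨f, hf1, hf0, -⟩ := exists_contMDiffMap_one_nhds_of_subset_interior 𝓘(ℝ, E) (n := 1)
    hK.isClosed hKL
  have hs : tsupport f ⊆ L := closure_minimal
    (fun x hx => by_contra fun h => hx (hf0 x h)) hL.isClosed
  exact ⟨f, f.contMDiff.contDiff, fun x hx => hf1.filter_mono (nhds_le_nhdsSet hx),
    hL.of_isClosed_subset (isClosed_tsupport _) hs, hs.trans hLU⟩

end Cutoff

/-! ### A Poincaré inequality on balls -/

section Poincare

variable {E : Type*} [NormedAddCommGroup E] [InnerProductSpace ℝ E] [FiniteDimensional ℝ E]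
  [MeasurableSpace E] [BorelSpace E]

/-- The increment is the integral of the derivative along the segment from x to x + z, which stays
in B by convexity. Tonelli and translation invariance then remove the shift. -/
theorem lintegral_enorm_translate_sub_le {u : E → ℝ} (hu : ContDiff ℝ 1 u) {B : Set E}
    (hB : Convex ℝ B) (hBm : MeasurableSet B) (z : E) :
    ∫⁻ x in B ∩ (fun x => x + z) ⁻¹' B, ‖u (x + z) - u x‖ₑ ≤ ‖z‖ₑ * ∫⁻ x in B, ‖∇ u x‖ₑ := by
  have hgc : Continuous (∇ u) := hu.continuous_gradient
  have hgm : Measurable fun x => ‖∇ u x‖ₑ := hgc.measurable.enorm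
  have hS : MeasurableSet (B ∩ (fun x => x + z) ⁻¹' B) :=
    hBm.inter (measurable_add_const z hBm)
  have hpt : ∀ x ∈ B ∩ (fun x => x + z) ⁻¹' B, ‖u (x + z) - u x‖ₑ ≤
      ∫⁻ t in Ioc (0 : ℝ) 1, ‖z‖ₑ * B.indicator (fun x => ‖∇ u x‖ₑ) (x + t • z) := by
    intro x hx
    have hd : ∀ t : ℝ, HasDerivAt (fun t : ℝ => u (x + t • z)) (fderiv ℝ u (x + t • z) z) t := by
      intro t
      have h1 : HasDerivAt (fun t : ℝ => x + t • z) z t := by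
        simpa using ((hasDerivAt_id t).smul_const z).const_add x
      exact ((hu.differentiable (by simp) _).hasFDerivAt).comp_hasDerivAt t h1
    have hcont : Continuous fun t : ℝ => fderiv ℝ u (x + t • z) z :=
      ((hu.continuous_fderiv (by simp)).comp (by fun_prop)).clm_apply continuous_const
    have hftc := intervalIntegral.integral_eq_sub_of_hasDerivAt (a := 0) (b := 1)
      (fun t _ => hd t) (hcont.intervalIntegrable _ _)
    simp only [one_smul, zero_smul, add_zero] at hftc
    rw [← hftc, intervalIntegral.integral_of_le zero_le_one]
    refine (enorm_integral_le_lintegral_enorm _).trans (setLIntegral_mono' measurableSet_Ioc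
      fun t ht => ?_)
    have hmem : x + t • z ∈ B := hB.add_smul_mem hx.1 hx.2 ⟨ht.1.le, ht.2⟩
    rw [indicator_of_mem hmem, enorm_gradient_eq, mul_comm]
    exact ContinuousLinearMap.le_opENorm _ _
  have hmeas : Measurable fun p : E × ℝ =>
      ‖z‖ₑ * B.indicator (fun x => ‖∇ u x‖ₑ) (p.1 + p.2 • z) :=
    ((hgm.indicator hBm).comp (by fun_prop)).const_mul _
  calc ∫⁻ x in B ∩ (fun x => x + z) ⁻¹' B, ‖u (x + z) - u x‖ₑ
      ≤ ∫⁻ x in B ∩ (fun x => x + z) ⁻¹' B, ∫⁻ t in Ioc (0 : ℝ) 1,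
          ‖z‖ₑ * B.indicator (fun x => ‖∇ u x‖ₑ) (x + t • z) := setLIntegral_mono' hS hpt
    _ ≤ ∫⁻ x, ∫⁻ t in Ioc (0 : ℝ) 1,
          ‖z‖ₑ * B.indicator (fun x => ‖∇ u x‖ₑ) (x + t • z) := setLIntegral_le_lintegral _ _
    _ = ∫⁻ t in Ioc (0 : ℝ) 1, ∫⁻ x,
          ‖z‖ₑ * B.indicator (fun x => ‖∇ u x‖ₑ) (x + t • z) :=
        lintegral_lintegral_swap hmeas.aemeasurable
    _ = ∫⁻ _t in Ioc (0 : ℝ) 1, ‖z‖ₑ * ∫⁻ x in B, ‖∇ u x‖ₑ := by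
        refine lintegral_congr fun t => ?_
        rw [lintegral_const_mul' _ _ (by simp),
          lintegral_add_right_eq_self (B.indicator fun x => ‖∇ u x‖ₑ), lintegral_indicator hBm]
    _ = _ := by simp

/-- Substituting y = x + z turns the double integral into translation increments, and only |z| < 2r
contributes. -/
theorem lintegral_ball_ball_enorm_sub_le {u : E → ℝ} (hu : ContDiff ℝ 1 u) (x₀ : E) (r : ℝ) :
    ∫⁻ x in ball x₀ r, ∫⁻ y in ball x₀ r, ‖u y - u x‖ₑ ≤
      ENNReal.ofReal (2 * r) * volume (ball (0 : E) (2 * r)) * ∫⁻ x in ball x₀ r, ‖∇ u x‖ₑ := by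
  set B := ball x₀ r
  have hBm : MeasurableSet B := measurableSet_ball
  have hmeas : Measurable fun p : E × E => B.indicator (fun _ => ‖u (p.1 + p.2) - u p.1‖ₑ)
      (p.1 + p.2) := by
    have h1 : Measurable fun p : E × E => ‖u (p.1 + p.2) - u p.1‖ₑ := by
      have := hu.continuous
      exact (by fun_prop : Continuous fun p : E × E => u (p.1 + p.2) - u p.1).measurable.enorm
    exact h1.indicator (s := (fun p : E × E => p.1 + p.2) ⁻¹' B)
      (hBm.preimage (by fun_prop))
  calc ∫⁻ x in B, ∫⁻ y in B, ‖u y - u x‖ₑ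
      = ∫⁻ x in B, ∫⁻ z, B.indicator (fun _ => ‖u (x + z) - u x‖ₑ) (x + z) := by
        refine lintegral_congr fun x => ?_
        rw [← lintegral_indicator hBm,
          ← lintegral_add_left_eq_self (B.indicator fun y => ‖u y - u x‖ₑ) x]
        rfl
    _ = ∫⁻ z, ∫⁻ x in B, B.indicator (fun _ => ‖u (x + z) - u x‖ₑ) (x + z) :=
        lintegral_lintegral_swap hmeas.aemeasurable
    _ = ∫⁻ z, ∫⁻ x in B ∩ (fun x => x + z) ⁻¹' B, ‖u (x + z) - u x‖ₑ := by
        refine lintegral_congr fun z => ?_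
        have hpm : MeasurableSet ((fun x => x + z) ⁻¹' B) := measurable_add_const z hBm
        rw [inter_comm, ← Measure.restrict_restrict hpm, ← lintegral_indicator hpm]
        rfl
    _ ≤ ∫⁻ z, (ball (0 : E) (2 * r)).indicator
          (fun _ => ENNReal.ofReal (2 * r) * ∫⁻ x in B, ‖∇ u x‖ₑ) z := by
        refine lintegral_mono fun z => ?_
        by_cases hz : z ∈ ball (0 : E) (2 * r)
        · rw [indicator_of_mem hz]
          refine (lintegral_enorm_translate_sub_le hu (convex_ball _ _) hBm z).trans ?_
          gcongr
          rw [← ofReal_norm]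
          exact ENNReal.ofReal_le_ofReal (mem_ball_zero_iff.1 hz).le
        · have : B ∩ (fun x => x + z) ⁻¹' B = ∅ := by
            refine eq_empty_of_forall_notMem fun x hx => hz ?_
            have h1 : dist x x₀ < r := hx.1
            have h2 : dist (x + z) x₀ < r := hx.2
            have h3 := dist_triangle_right (x + z) x x₀
            rw [mem_ball_zero_iff]
            rw [dist_eq_norm, add_sub_cancel_left] at h3
            linarith
          simp [this]
    _ = _ := by
        rw [lintegral_indicator measurableSet_ball, setLIntegral_const]
        ring

/-- A Poincaré-type inequality for `h(w)`. -/
theorem HasC1Approx.volume_mul_volume_le {D : Opens E} {w : E → ℝ} {G : E → E}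
    (hA : HasC1Approx D w G) {x₀ : E} {r R : ℝ} (hr : 0 ≤ r) (hrR : r < R)
    (hRD : closedBall x₀ R ⊆ D) {h h' : ℝ → ℝ} (hh : ∀ s, HasDerivAt h (h' s) s)
    (hh' : Continuous h') {S T : Set E} (hSm : MeasurableSet S) (hTm : MeasurableSet T)
    (hSB : S ⊆ ball x₀ r) (hTB : T ⊆ ball x₀ r) (hS : ∀ x ∈ S, h (w x) = 1)
    (hT : ∀ x ∈ T, h (w x) = 0) :
    volume S * volume T ≤ 2 * (ENNReal.ofReal (2 * r) * volume (ball (0 : E) (2 * r))) *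
      ∫⁻ x in ball x₀ r, ‖h' (w x) • G x‖ₑ := by
  obtain ⟨C, -, hcut⟩ := exists_cutoff_ball E
  -- η is 1 on the ball of radius r, so there the gradient of η h(w) reduces to h'(w) G.
  obtain ⟨η, hη, -, -, hη1, hηs, -⟩ := hcut x₀ r R hr hrR
  have hηc : HasCompactSupport η :=
    (isCompact_closedBall x₀ R).of_isClosed_subset (isClosed_tsupport _) hηs
  obtain ⟨u, hu1, -, huu, hug⟩ :=
    hA.exists_seq_mul_comp_lintegral hη hηc (hηs.trans hRD) hh hh'
  set c := ENNReal.ofReal (2 * r) * volume (ball (0 : E) (2 * r)) with hc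
  have hctop : c ≠ ⊤ := ENNReal.mul_ne_top ENNReal.ofReal_ne_top measure_ball_lt_top.ne
  set F : E → E := fun x => h (w x) • ∇ η x + (η x * h' (w x)) • G x with hF
  have hFB : ∀ x ∈ ball x₀ r, F x = h' (w x) • G x := by
    intro x hx
    have h1 : η =ᶠ[𝓝 x] fun _ => 1 := by
      filter_upwards [isOpen_ball.mem_nhds hx] with y hy
      exact hη1 y (ball_subset_closedBall hy)
    have h2 : ∇ η x = 0 := by rw [h1.gradient_eq, gradient_fun_const]
    rw [hF]
    simp [h2, h1.self_of_nhds]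
  have hFI : ∫⁻ x in ball x₀ r, ‖F x‖ₑ = ∫⁻ x in ball x₀ r, ‖h' (w x) • G x‖ₑ :=
    setLIntegral_congr_fun measurableSet_ball fun x hx => by rw [hFB x hx]
  have hFm : AEMeasurable (fun x => ‖F x‖ₑ) (volume.restrict (ball x₀ r)) :=
    (hA.memLp_gradient_mul_comp hη hηc (hηs.trans hRD)
        (continuous_iff_continuousAt.2 fun s => (hh s).continuousAt) hh').1.enorm.restrict
  have hlim : Tendsto (fun n => 2 * c * ((∫⁻ x in ball x₀ r, ‖F x‖ₑ) +
      ∫⁻ x, ‖∇ (u n) x - F x‖ₑ)) atTop (𝓝 (2 * c * ∫⁻ x in ball x₀ r, ‖F x‖ₑ)) := by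
    refine ENNReal.Tendsto.const_mul ?_ (Or.inr (ENNReal.mul_ne_top (by simp) hctop))
    simpa using (tendsto_const_nhds (x := ∫⁻ x in ball x₀ r, ‖F x‖ₑ)).add hug
  rw [← hFI]
  refine ge_of_tendsto hlim ?_
  -- An error below 1/4 at both points leaves a gap of at least 1/2 between values on S and on T;
  -- this is the source of the factor 2.
  filter_upwards [Metric.tendstoUniformly_iff.1 huu (1 / 4) (by norm_num)] with n hn
  have hST : ∀ x ∈ S, ∀ y ∈ T, (2 : ℝ≥0∞)⁻¹ ≤ ‖u n y - u n x‖ₑ := by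
    intro x hx y hy
    have h1 := hn x
    have h2 := hn y
    rw [hη1 x (ball_subset_closedBall (hSB hx)), hS x hx, Real.dist_eq, abs_lt] at h1
    rw [hη1 y (ball_subset_closedBall (hTB hy)), hT y hy, Real.dist_eq, abs_lt] at h2
    have h3 : (2 : ℝ)⁻¹ ≤ |u n y - u n x| := by
      rw [abs_sub_comm]
      refine le_trans ?_ (le_abs_self _)
      linarith
    rw [← ofReal_norm, Real.norm_eq_abs]
    refine le_trans (le_of_eq ?_) (ENNReal.ofReal_le_ofReal h3)
    rw [ENNReal.ofReal_inv_of_pos (by norm_num)]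
    simp
  have h1 : (2 : ℝ≥0∞)⁻¹ * volume T * volume S ≤
      c * ((∫⁻ x in ball x₀ r, ‖F x‖ₑ) + ∫⁻ x, ‖∇ (u n) x - F x‖ₑ) := by
    calc (2 : ℝ≥0∞)⁻¹ * volume T * volume S
        = ∫⁻ _x in S, ∫⁻ _y in T, (2 : ℝ≥0∞)⁻¹ := by simp
      _ ≤ ∫⁻ x in S, ∫⁻ y in T, ‖u n y - u n x‖ₑ :=
          setLIntegral_mono' hSm fun x hx => setLIntegral_mono' hTm fun y hy => hST x hx y hy
      _ ≤ ∫⁻ x in ball x₀ r, ∫⁻ y in ball x₀ r, ‖u n y - u n x‖ₑ := by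
          refine (lintegral_mono_set hSB).trans (lintegral_mono fun x => lintegral_mono_set hTB)
      _ ≤ c * ∫⁻ x in ball x₀ r, ‖∇ (u n) x‖ₑ := lintegral_ball_ball_enorm_sub_le (hu1 n) x₀ r
      _ ≤ _ := by
          gcongr
          refine le_trans ?_ (add_le_add_right (setLIntegral_le_lintegral (ball x₀ r) _) _)
          rw [← lintegral_add_left' hFm]
          refine lintegral_mono fun x => ?_
          calc ‖∇ (u n) x‖ₑ = ‖F x + (∇ (u n) x - F x)‖ₑ := by rw [add_sub_cancel]
            _ ≤ _ := enorm_add_le _ _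
  calc volume S * volume T = 2 * ((2 : ℝ≥0∞)⁻¹ * volume T * volume S) := by
        rw [mul_assoc, ← mul_assoc, ENNReal.mul_inv_cancel (by simp) (by simp), one_mul, mul_comm]
    _ ≤ _ := by
        rw [mul_assoc 2 c]
        exact mul_le_mul' le_rfl h1

end Poincare

/-! ### The weak maximum principle -/

/-- The sequence 2⁻ⁿ a n is nondecreasing, yet bounded above by a polynomial times 2⁻ⁿ, which tends
to 0. -/
theorem le_zero_of_le_half_of_polynomial_growth {a : ℕ → ℝ} {A : ℝ} {d : ℕ}
    (h : ∀ n, a n ≤ 1 / 2 * a (n + 1)) (hA : ∀ n, a n ≤ A * (n : ℝ) ^ d) (n : ℕ) : a n ≤ 0 := by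
  have hmono : Monotone fun n => (1 / 2 : ℝ) ^ n * a n := by
    refine monotone_nat_of_le_succ fun n => ?_
    rw [pow_succ, mul_assoc]
    exact mul_le_mul_of_nonneg_left (h n) (by positivity)
  have hlim : Tendsto (fun n : ℕ => A * ((n : ℝ) ^ d * (1 / 2) ^ n)) atTop (𝓝 (A * 0)) :=
    (tendsto_pow_const_mul_const_pow_of_abs_lt_one d
      (by rw [abs_of_pos] <;> norm_num)).const_mul A
  rw [mul_zero] at hlim
  have hle : (1 / 2 : ℝ) ^ n * a n ≤ 0 := by
    refine ge_of_tendsto hlim ?_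
    filter_upwards [eventually_ge_atTop n] with m hm
    refine (hmono hm).trans ?_
    calc (1 / 2 : ℝ) ^ m * a m ≤ (1 / 2 : ℝ) ^ m * (A * (m : ℝ) ^ d) := by
          gcongr
          exact hA m
      _ = _ := by ring
  exact nonpos_of_mul_nonpos_right hle (by positivity)

section MaximumPrinciple

variable {E : Type*} [NormedAddCommGroup E] [InnerProductSpace ℝ E] [FiniteDimensional ℝ E]
  [MeasurableSpace E] [BorelSpace E] {D : Opens E} {w : E → ℝ} {G : E → E} {σ : E → ℝ}
  {μ M lam : ℝ}

theorem integrableOn_inter_closedBall_of_bounded {f : E → ℝ} (hf : ContinuousOn f D) {C : ℝ}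
    (hC : ∀ x ∈ D, |f x| ≤ C) (R : ℝ) : IntegrableOn f (D ∩ closedBall 0 R) volume := by
  have hm : MeasurableSet ((D : Set E) ∩ closedBall 0 R) :=
    D.isOpen.measurableSet.inter measurableSet_closedBall
  refine IntegrableOn.of_bound ((measure_mono inter_subset_right).trans_lt
    measure_closedBall_lt_top) ((hf.mono inter_subset_left).aestronglyMeasurable hm) C ?_
  filter_upwards [ae_restrict_mem hm] with x hx
  exact hC x hx.1

/-- Energy decay for the part of `w` below a negative level. -/
theorem IsEllipticSupersolution.energy_decay (hS : IsEllipticSupersolution D σ μ M lam w G) {C : ℝ}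
    (hC : ∀ x ∈ D, |w x| ≤ C) (hcont : ContinuousOn w (closure D))
    (hbdry : ∀ x ∈ frontier (D : Set E), 0 ≤ w x) {δ : ℝ} (hδ : 0 < δ) {r R c : ℝ}
    {ζ : E → ℝ} (hζ : ContDiff ℝ 1 ζ) (hζ1 : ∀ x ∈ closedBall 0 r, ζ x = 1)
    (hζs : tsupport ζ ⊆ closedBall 0 R) (hζg : ∀ x, ‖∇ ζ x‖ ≤ c) :
    lam * ∫ x in (D : Set E) ∩ closedBall 0 r, max (-δ - w x) 0 ^ 4 ≤
      M * c ^ 2 * ∫ x in (D : Set E) ∩ closedBall 0 R, max (-δ - w x) 0 ^ 4 := by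
  have hw := hS.hasC1Approx.continuousOn
  have hDm := D.isOpen.measurableSet
  -- This set is closed and bounded, and it avoids the frontier because w ≥ 0 there, so it is a
  -- compact subset of D. A cutoff χ equal to 1 near it makes χζ admissible without changing the
  -- integrals, as (-δ - w)₊ vanishes at the other points of D in the ball.
  have hK : IsCompact ((closure D ∩ w ⁻¹' Iic (-δ)) ∩ closedBall (0 : E) R) :=
    (isCompact_closedBall 0 R).inter_left
      (hcont.preimage_isClosed_of_isClosed isClosed_closure isClosed_Iic)
  have hKD : (closure D ∩ w ⁻¹' Iic (-δ)) ∩ closedBall (0 : E) R ⊆ D := by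
    rintro x ⟨⟨hx, hwx⟩, -⟩
    by_contra hxD
    have h1 := hbdry x ⟨hx, by rwa [D.isOpen.interior_eq]⟩
    have h2 : w x ≤ -δ := hwx
    linarith
  obtain ⟨χ, hχ, hχ1, hχc, hχD⟩ := exists_cutoff_compact hK D.isOpen hKD
  have hηc : HasCompactSupport fun x => χ x * ζ x := hχc.mul_right
  have hηs : tsupport (fun x => χ x * ζ x) ⊆ tsupport ζ := tsupport_mul_subset_right
  have hcac := hS.caccioppoli (-δ) (hχ.mul hζ) hηc (tsupport_mul_subset_left.trans hχD)
  have hp4 : ContinuousOn (fun x => max (-δ - w x) 0 ^ 4) D :=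
    ((continuousOn_const.sub hw).sup continuousOn_const).pow 4
  have hp4C : ∀ x ∈ D, |max (-δ - w x) 0 ^ 4| ≤ C ^ 4 := by
    intro x hx
    have h1 := hC x hx
    rw [abs_of_nonneg (by positivity)]
    have : max (-δ - w x) 0 ≤ C := by
      rw [abs_le] at h1
      exact max_le (by linarith) (by linarith)
    gcongr
  have hint := integrableOn_inter_closedBall_of_bounded hp4 hp4C
  have hQ0 : 0 ≤ 2 * μ * ∫ x in (D : Set E),
      max (-δ - w x) 0 ^ 2 * (χ x * ζ x) ^ 2 * ‖G x‖ ^ 2 :=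
    mul_nonneg (by linarith [hS.pos]) (integral_nonneg fun x => by positivity)
  have hind : ∀ ρ : ℝ, IntegrableOn ((closedBall (0 : E) ρ).indicator
      fun x => max (-δ - w x) 0 ^ 4) D volume := fun ρ => by
    rw [IntegrableOn, integrable_indicator_iff measurableSet_closedBall, IntegrableOn,
      Measure.restrict_restrict measurableSet_closedBall, inter_comm]
    exact hint ρ
  have hindI : ∀ ρ : ℝ, ∫ x in (D : Set E), (closedBall (0 : E) ρ).indicator
      (fun x => max (-δ - w x) 0 ^ 4) x =
      ∫ x in (D : Set E) ∩ closedBall 0 ρ, max (-δ - w x) 0 ^ 4 := fun ρ =>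
    setIntegral_indicator measurableSet_closedBall
  have hb : IntegrableOn (fun x => M * c ^ 2 * (closedBall (0 : E) R).indicator
      (fun x => max (-δ - w x) 0 ^ 4) x - lam * (closedBall (0 : E) r).indicator
      (fun x => max (-δ - w x) 0 ^ 4) x) D volume :=
    ((hind R).const_mul _).sub ((hind r).const_mul _)
  have hpt : ∀ x ∈ (D : Set E), M * (max (-δ - w x) 0 ^ 4 * ‖∇ (fun x => χ x * ζ x) x‖ ^ 2) +
      lam * (w x * max (-δ - w x) 0 ^ 3 * (χ x * ζ x) ^ 2) ≤
      M * c ^ 2 * (closedBall (0 : E) R).indicator (fun x => max (-δ - w x) 0 ^ 4) x -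
        lam * (closedBall (0 : E) r).indicator (fun x => max (-δ - w x) 0 ^ 4) x := by
    intro x hx
    have hM0 : 0 ≤ M := hS.pos.le.trans ((hS.bounds x hx).1.trans (hS.bounds x hx).2)
    have hlam := hS.lam_pos
    rcases le_or_gt (-δ - w x) 0 with hp | hp
    · have h0 : max (-δ - w x) 0 = 0 := max_eq_right hp
      have hi : ∀ ρ : ℝ, (closedBall (0 : E) ρ).indicator
          (fun x => max (-δ - w x) 0 ^ 4) x = 0 := fun ρ =>
        indicator_apply_eq_zero.2 fun _ => by rw [h0]; norm_num
      rw [hi, hi, h0]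
      norm_num
    · have hp' : max (-δ - w x) 0 = -δ - w x := max_eq_left hp.le
      -- Here w = -δ - p ≤ -p, so the zero-order term is at most -lam p⁴ ζ². This negative term is
      -- what controls the inner ball.
      have hwp : w x * max (-δ - w x) 0 ^ 3 ≤ -max (-δ - w x) 0 ^ 4 := by
        rw [hp']
        have : w x ≤ -(-δ - w x) := by linarith
        calc w x * (-δ - w x) ^ 3 ≤ -(-δ - w x) * (-δ - w x) ^ 3 := by gcongr
          _ = _ := by ring
      by_cases hxR : x ∈ closedBall (0 : E) R
      · have hxK : x ∈ (closure D ∩ w ⁻¹' Iic (-δ)) ∩ closedBall (0 : E) R :=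
          ⟨⟨subset_closure hx, by simp only [mem_preimage, mem_Iic]; linarith⟩, hxR⟩
        have h1 : (fun x => χ x * ζ x) =ᶠ[𝓝 x] ζ := by
          filter_upwards [hχ1 x hxK] with y hy
          rw [hy, one_mul]
        have h2 : χ x = 1 := (hχ1 x hxK).self_of_nhds
        rw [h1.gradient_eq, h2, one_mul, indicator_of_mem hxR]
        have h3 : max (-δ - w x) 0 ^ 4 * ‖∇ ζ x‖ ^ 2 ≤ max (-δ - w x) 0 ^ 4 * c ^ 2 := by
          gcongr
          exact hζg x
        have h4 : w x * max (-δ - w x) 0 ^ 3 * ζ x ^ 2 ≤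
            -(closedBall (0 : E) r).indicator (fun x => max (-δ - w x) 0 ^ 4) x := by
          by_cases hxr : x ∈ closedBall (0 : E) r
          · rw [indicator_of_mem hxr, hζ1 x hxr]
            linarith
          · rw [indicator_of_notMem hxr, neg_zero]
            refine mul_nonpos_of_nonpos_of_nonneg (hwp.trans ?_) (sq_nonneg _)
            rw [neg_nonpos]
            positivity
        have h5 := mul_le_mul_of_nonneg_left h3 hM0
        have h6 := mul_le_mul_of_nonneg_left h4 hlam.le
        linarith
      · have hz : x ∉ tsupport fun x => χ x * ζ x := fun h => hxR (hζs (hηs h))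
        have h1 : ∇ (fun x => χ x * ζ x) x = 0 :=
          image_eq_zero_of_notMem_tsupport fun h => hz (tsupport_gradient_subset _ h)
        have h2 : χ x * ζ x = 0 :=
          image_eq_zero_of_notMem_tsupport (f := fun x => χ x * ζ x) hz
        rw [h1, h2, indicator_of_notMem hxR]
        -- The inner ball cannot leave the outer one: ζ would be both 1 and 0 at x.
        by_cases hxr : x ∈ closedBall (0 : E) r
        · have h3 := hζ1 x hxr
          have h4 : x ∉ tsupport ζ := fun h => hxR (hζs h)
          rw [image_eq_zero_of_notMem_tsupport h4] at h3
          exact absurd h3 zero_ne_one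
        · rw [indicator_of_notMem hxr]
          simp
  have hle := hQ0.trans hcac
  have := hle.trans (setIntegral_mono_on (hS.integrableOn_caccioppoli (-δ) (hχ.mul hζ) hηc
    (tsupport_mul_subset_left.trans hχD)) hb hDm hpt)
  rw [integral_sub ((hind R).const_mul _) ((hind r).const_mul _), integral_const_mul,
    integral_const_mul, hindI, hindI] at this
  linarith

/-- The weak maximum principle. -/
theorem IsEllipticSupersolution.nonneg (hS : IsEllipticSupersolution D σ μ M lam w G) {C : ℝ}
    (hC : ∀ x ∈ D, |w x| ≤ C) (hcont : ContinuousOn w (closure D))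
    (hbdry : ∀ x ∈ frontier (D : Set E), 0 ≤ w x) : ∀ x ∈ D, 0 ≤ w x := by
  intro x₀ hx₀
  refine le_of_forall_pos_sub_le fun δ hδ => ?_
  have hw := hS.hasC1Approx.continuousOn
  have hM : 0 < M := hS.pos.trans_le ((hS.bounds x₀ hx₀).1.trans (hS.bounds x₀ hx₀).2)
  obtain ⟨A, hA, hcut⟩ := exists_cutoff_ball E
  have hlam := hS.lam_pos
  obtain ⟨L, hL, hLle⟩ : ∃ L : ℝ, 0 < L ∧ M * (A / L) ^ 2 ≤ lam * (1 / 2) := by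
    -- This L solves M (A / L)² = lam / 2, so that each step of length L halves the energy.
    refine ⟨A * √(2 * M / lam), by positivity, ?_⟩
    rw [div_mul_cancel_left₀ hA.ne', inv_pow, Real.sq_sqrt (by positivity)]
    refine le_of_eq ?_
    field_simp
  set a : ℕ → ℝ := fun n => ∫ x in (D : Set E) ∩ closedBall 0 (n * L), max (-δ - w x) 0 ^ 4
  have ha0 : ∀ n, 0 ≤ a n := fun n => integral_nonneg fun x => by positivity
  have h1 : ∀ n, a n ≤ 1 / 2 * a (n + 1) := by
    intro n
    obtain ⟨ζ, hζ, -, -, hζ1, hζs, hζg⟩ := hcut 0 (n * L) ((n + 1 : ℕ) * L) (by positivity)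
      (by push_cast; nlinarith)
    have := hS.energy_decay hC hcont hbdry hδ hζ hζ1 hζs hζg
    have hLL : ((n + 1 : ℕ) : ℝ) * L - n * L = L := by push_cast; ring
    rw [hLL] at this
    have h2 : lam * a n ≤ lam * (1 / 2) * a (n + 1) :=
      this.trans (mul_le_mul_of_nonneg_right hLle (ha0 _))
    rw [mul_assoc] at h2
    exact le_of_mul_le_mul_left h2 hlam
  have hp4 : ContinuousOn (fun x => max (-δ - w x) 0 ^ 4) D :=
    ((continuousOn_const.sub hw).sup continuousOn_const).pow 4
  have hp4C : ∀ x ∈ D, max (-δ - w x) 0 ^ 4 ≤ C ^ 4 := by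
    intro x hx
    have h1 := hC x hx
    have : max (-δ - w x) 0 ≤ C := by
      rw [abs_le] at h1
      exact max_le (by linarith) (by linarith)
    gcongr
  have hp4C' : ∀ x ∈ D, |max (-δ - w x) 0 ^ 4| ≤ C ^ 4 := fun x hx => by
    rw [abs_of_nonneg (by positivity)]
    exact hp4C x hx
  have hDm := D.isOpen.measurableSet
  have h2 : ∀ n : ℕ, a n ≤ C ^ 4 * (L ^ Module.finrank ℝ E * volume.real (ball (0 : E) 1)) *
      (n : ℝ) ^ Module.finrank ℝ E := by
    intro n
    have hC4 : (0 : ℝ) ≤ C ^ 4 := by positivity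
    calc a n ≤ ∫ _x in (D : Set E) ∩ closedBall 0 (n * L), C ^ 4 :=
          setIntegral_mono_on (integrableOn_inter_closedBall_of_bounded hp4 hp4C' _)
            (integrableOn_const ((measure_mono inter_subset_right).trans_lt
              measure_closedBall_lt_top).ne)
            (hDm.inter measurableSet_closedBall) fun x hx => hp4C x hx.1
      _ = volume.real ((D : Set E) ∩ closedBall 0 (n * L)) * C ^ 4 := by
          rw [setIntegral_const, smul_eq_mul]
      _ ≤ volume.real (closedBall (0 : E) (n * L)) * C ^ 4 := by
          gcongr
          · exact measure_closedBall_lt_top.ne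
          · exact inter_subset_right
      _ = _ := by
          rw [Measure.real, Measure.addHaar_closedBall _ _ (by positivity), ENNReal.toReal_mul,
            ENNReal.toReal_ofReal (by positivity), mul_pow, Measure.real]
          ring
  have h3 := le_zero_of_le_half_of_polynomial_growth h1 h2
  obtain ⟨n, hn⟩ := exists_nat_gt (‖x₀‖ / L)
  have hxn : x₀ ∈ ball (0 : E) (n * L) := by
    rw [mem_ball_zero_iff]
    exact (div_lt_iff₀ hL).1 hn
  have h4 : (fun x => max (-δ - w x) 0 ^ 4) =ᵐ[volume.restrict (D ∩ closedBall 0 (n * L))] 0 :=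
    (setIntegral_eq_zero_iff_of_nonneg_ae (ae_of_all _ fun x => by positivity)
      (integrableOn_inter_closedBall_of_bounded hp4 hp4C' _)).1 (le_antisymm (h3 n) (ha0 n))
  -- Passing to an open ball lets continuity upgrade vanishing almost everywhere to vanishing at x₀.
  have h5 : (fun x => max (-δ - w x) 0 ^ 4) =ᵐ[volume.restrict (D ∩ ball 0 (n * L))] 0 :=
    ae_restrict_of_ae_restrict_of_subset (inter_subset_inter_right _ ball_subset_closedBall) h4
  have h6 := Measure.eqOn_open_of_ae_eq h5 (D.isOpen.inter isOpen_ball)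
    (hp4.mono inter_subset_left) continuousOn_const ⟨hx₀, hxn⟩
  have h7 : max (-δ - w x₀) 0 = 0 := by simpa using h6
  have h8 := max_eq_right_iff.1 h7
  linarith

end MaximumPrinciple

/-! ### De Giorgi iteration -/

/-- De Giorgi's lemma on fast geometric convergence. -/
theorem exists_threshold_tendsto_zero {K b q : ℝ} (hK : 0 < K) (hb : 1 < b) (hq : 1 < q) :
    ∃ ν : ℝ, 0 < ν ∧ ∀ V : ℕ → ℝ, (∀ j, 0 ≤ V j) → (∀ j, V (j + 1) ≤ K * (b ^ j * V j) ^ q) →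
      V 0 ≤ ν → Tendsto V atTop (𝓝 0) := by
  have hb0 : 0 < b := zero_lt_one.trans hb
  have hq1 : 0 < q - 1 := sub_pos.2 hq
  -- τ solves b^q τ^(q-1) = 1 and ν below solves K ν^(q-1) = τ; these are exactly what the induction
  -- V j ≤ ν τ^j requires.
  set τ : ℝ := b ^ (-(q / (q - 1))) with hτ
  have hτ0 : 0 < τ := Real.rpow_pos_of_pos hb0 _
  have hτ1 : τ < 1 := Real.rpow_lt_one_of_one_lt_of_neg hb (by
    rw [neg_lt_zero]; positivity)
  have hbτ : b ^ q * τ ^ (q - 1) = 1 := by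
    rw [hτ, ← Real.rpow_mul hb0.le, ← Real.rpow_add hb0]
    have : q + -(q / (q - 1)) * (q - 1) = 0 := by field_simp; ring
    rw [this, Real.rpow_zero]
  set ν : ℝ := (τ / K) ^ (q - 1)⁻¹ with hν
  have hν0 : 0 < ν := Real.rpow_pos_of_pos (by positivity) _
  have hνq : K * ν ^ (q - 1) = τ := by
    rw [hν, ← Real.rpow_mul (by positivity), inv_mul_cancel₀ hq1.ne', Real.rpow_one]
    field_simp
  have hsplit : ∀ y : ℝ, 0 < y → y ^ q = y ^ (q - 1) * y := fun y hy => by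
    rw [← Real.rpow_add_one hy.ne']; congr 1; ring
  refine ⟨ν, hν0, fun V hV0 hV hVν => ?_⟩
  have hbound : ∀ j, V j ≤ ν * τ ^ j := by
    intro j
    induction j with
    | zero => simpa using hVν
    | succ j ih =>
      calc V (j + 1) ≤ K * (b ^ j * V j) ^ q := hV j
        _ ≤ K * (b ^ j * (ν * τ ^ j)) ^ q := by
          have := hV0 j
          gcongr
        _ = (K * ν ^ (q - 1)) * ν * ((b ^ q * τ ^ (q - 1)) ^ j * τ ^ j) := by
          rw [Real.mul_rpow (by positivity) (by positivity),
            Real.mul_rpow (by positivity) (by positivity), hsplit ν hν0,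
            ← Real.rpow_natCast b, ← Real.rpow_natCast τ, ← Real.rpow_mul hb0.le,
            ← Real.rpow_mul hτ0.le, mul_comm (j : ℝ) q, Real.rpow_mul hb0.le,
            Real.rpow_mul hτ0.le, hsplit τ hτ0, Real.rpow_natCast, Real.rpow_natCast,
            Real.rpow_natCast]
          ring
        _ = ν * τ ^ (j + 1) := by
          rw [hνq, hbτ, one_pow]; ring
  refine tendsto_of_tendsto_of_tendsto_of_le_of_le tendsto_const_nhds ?_ hV0 hbound
  simpa using (tendsto_pow_atTop_nhds_zero_of_lt_one hτ0.le hτ1).const_mul ν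

theorem tendsto_measure_inter_preimage_Iio {α : Type*} [MeasurableSpace α] {ν : Measure α}
    {f : α → ℝ} {S : Set α} (hm : ∀ t, MeasurableSet (S ∩ f ⁻¹' Iio t)) (hS : ν S ≠ ⊤) :
    Tendsto (fun t => ν (S ∩ f ⁻¹' Iio t)) (𝓝[>] 0) (𝓝 (ν (S ∩ f ⁻¹' Iic 0))) := by
  have h := tendsto_measure_biInter_gt (μ := ν) (s := fun t => S ∩ f ⁻¹' Iio t) (a := (0 : ℝ))
    (fun t _ => (hm t).nullMeasurableSet)
    (fun i j _ hij => inter_subset_inter_right _ (preimage_mono (Iio_subset_Iio hij)))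
    ⟨1, one_pos, ne_top_of_le_ne_top hS (measure_mono inter_subset_left)⟩
  have heq : S ∩ f ⁻¹' Iic 0 = ⋂ t > (0 : ℝ), S ∩ f ⁻¹' Iio t := ?_
  · rw [heq]
    exact h
  ext x
  simp only [mem_inter_iff, mem_preimage, mem_Iic, mem_iInter, mem_Iio]
  constructor
  · exact fun hx t ht => ⟨hx.1, hx.2.trans_lt ht⟩
  · exact fun hx => ⟨(hx 1 one_pos).1, le_of_forall_gt fun t ht => (hx t ht).2⟩

theorem measurableSet_closedBall_inter_preimage_Iio {E : Type*} [NormedAddCommGroup E]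
    [MeasurableSpace E] [BorelSpace E] {D : Opens E} {w : E → ℝ} (hw : ContinuousOn w D) {x₀ : E} {R : ℝ}
    (hRD : closedBall x₀ R ⊆ D) (t : ℝ) : MeasurableSet (closedBall x₀ R ∩ w ⁻¹' Iio t) := by
  have h1 : IsClosed (closedBall x₀ R ∩ w ⁻¹' Ici t) :=
    (hw.mono hRD).preimage_isClosed_of_isClosed isClosed_closedBall isClosed_Ici
  have h2 : closedBall x₀ R ∩ w ⁻¹' Iio t = closedBall x₀ R \ (closedBall x₀ R ∩ w ⁻¹' Ici t) := by
    ext x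
    simp only [mem_inter_iff, mem_preimage, mem_Iio, mem_Ici, Set.mem_sdiff, not_and, not_le]
    exact ⟨fun h => ⟨h.1, fun _ => h.2⟩, fun h => ⟨h.1, h.2 h.1⟩⟩
  rw [h2]
  exact measurableSet_closedBall.diff h1.measurableSet

section DeGiorgiStep

variable {E : Type*} [NormedAddCommGroup E] [InnerProductSpace ℝ E] [FiniteDimensional ℝ E]
  [MeasurableSpace E] [BorelSpace E] {D : Opens E} {w : E → ℝ} {G : E → E} {σ : E → ℝ}
  {μ M lam : ℝ}

/-- With w ≥ 0 the integrand on the right of the Caccioppoli inequality lives on {w < k}, where both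
w and (k - w)₊ are at most k. -/
theorem IsEllipticSupersolution.energy_le (hS : IsEllipticSupersolution D σ μ M lam w G)
    (hw0 : ∀ x ∈ D, 0 ≤ w x) {x₀ : E} {R : ℝ} (hRD : closedBall x₀ R ⊆ D) {k c : ℝ} (hk : 0 < k)
    {η : E → ℝ} (hη : ContDiff ℝ 1 η) (hη1 : ∀ x, |η x| ≤ 1) (hηs : tsupport η ⊆ closedBall x₀ R)
    (hηg : ∀ x, ‖∇ η x‖ ≤ c) :
    ∫ x in (D : Set E), max (k - w x) 0 ^ 2 * η x ^ 2 * ‖G x‖ ^ 2 ≤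
      (M * c ^ 2 + lam) / (2 * μ) * k ^ 4 * volume.real (closedBall x₀ R ∩ w ⁻¹' Iio k) := by
  have hηc : HasCompactSupport η :=
    (isCompact_closedBall x₀ R).of_isClosed_subset (isClosed_tsupport _) hηs
  have hcac := hS.caccioppoli k hη hηc (hηs.trans hRD)
  have hRint := hS.integrableOn_caccioppoli k hη hηc (hηs.trans hRD)
  have hSm := measurableSet_closedBall_inter_preimage_Iio hS.hasC1Approx.continuousOn hRD k
  set S := closedBall x₀ R ∩ w ⁻¹' Iio k with hSdef
  have hSfin : volume S ≠ ⊤ := ((measure_mono inter_subset_left).trans_lt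
    measure_closedBall_lt_top).ne
  have hSD : S ⊆ D := inter_subset_left.trans hRD
  have hμ := hS.pos
  have hlam := hS.lam_pos
  have hle : ∫ x in (D : Set E), (M * (max (k - w x) 0 ^ 4 * ‖∇ η x‖ ^ 2) +
      lam * (w x * max (k - w x) 0 ^ 3 * η x ^ 2)) ≤
      ∫ x in (D : Set E), S.indicator (fun _ => (M * c ^ 2 + lam) * k ^ 4) x := by
    refine setIntegral_mono_on hRint ((integrable_indicator_iff hSm).2 ?_) D.isOpen.measurableSet
      fun x hx => ?_
    · exact integrableOn_const (ne_top_of_le_ne_top hSfin (Measure.restrict_apply_le _ _))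
    have hM0 : 0 ≤ M := hμ.le.trans ((hS.bounds x hx).1.trans (hS.bounds x hx).2)
    by_cases hxS : x ∈ S
    · rw [indicator_of_mem hxS]
      have hwk : w x < k := hxS.2
      have hw := hw0 x hx
      have hp : max (k - w x) 0 ≤ k := max_le (by linarith) hk.le
      have hp0 : 0 ≤ max (k - w x) 0 := le_max_right _ _
      have h1 : max (k - w x) 0 ^ 4 * ‖∇ η x‖ ^ 2 ≤ k ^ 4 * c ^ 2 := by
        gcongr
        exact hηg x
      have h2 : w x * max (k - w x) 0 ^ 3 * η x ^ 2 ≤ k * k ^ 3 * 1 ^ 2 := by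
        rw [← sq_abs (η x)]
        gcongr
        exact hη1 x
      have h3 := mul_le_mul_of_nonneg_left h1 hM0
      have h4 := mul_le_mul_of_nonneg_left h2 hlam.le
      linarith
    · rw [indicator_of_notMem hxS]
      by_cases hxR : x ∈ closedBall x₀ R
      · have hwk : k ≤ w x := le_of_not_gt fun h => hxS ⟨hxR, h⟩
        have hp : max (k - w x) 0 = 0 := max_eq_right (by linarith)
        rw [hp]
        norm_num
      · have h1 : η x = 0 := image_eq_zero_of_notMem_tsupport fun h => hxR (hηs h)
        have h2 : ∇ η x = 0 := image_eq_zero_of_notMem_tsupport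
          fun h => hxR (hηs (tsupport_gradient_subset _ h))
        simp [h1, h2]
  rw [setIntegral_indicator hSm, inter_eq_self_of_subset_right hSD, setIntegral_const,
    smul_eq_mul] at hle
  have h5 := hcac.trans hle
  have h6 : (M * c ^ 2 + lam) / (2 * μ) * k ^ 4 * volume.real S =
      (volume.real S * ((M * c ^ 2 + lam) * k ^ 4)) / (2 * μ) := by ring
  rw [h6, le_div_iff₀ (by positivity)]
  linarith

/-- One step of the De Giorgi iteration. -/
theorem IsEllipticSupersolution.deGiorgi_step (hS : IsEllipticSupersolution D σ μ M lam w G)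
    (hw0 : ∀ x ∈ D, 0 ≤ w x) {q : ℝ} (hq : Real.HolderConjugate (Module.finrank ℝ E) q)
    {x₀ : E} {r R : ℝ} (hrR : r < R) (hRD : closedBall x₀ R ⊆ D) {k l c : ℝ} (hk : 0 < k)
    (hlk : l < k) {η : E → ℝ} (hη : ContDiff ℝ 1 η) (hη1 : ∀ x, |η x| ≤ 1)
    (hηr : ∀ x ∈ closedBall x₀ r, η x = 1) (hηs : tsupport η ⊆ closedBall x₀ R)
    (hηg : ∀ x, ‖∇ η x‖ ≤ c) :
    volume.real (closedBall x₀ r ∩ w ⁻¹' Iio l) ≤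
      lintegralPowLePowLIntegralFDerivConst (volume : Measure E) q *
        (k ^ 2 / (k - l) ^ 2 * (c + 1 + (M * c ^ 2 + lam) / (2 * μ)) *
          volume.real (closedBall x₀ R ∩ w ⁻¹' Iio k)) ^ q := by
  have hA := hS.hasC1Approx
  have hηc : HasCompactSupport η :=
    (isCompact_closedBall x₀ R).of_isClosed_subset (isClosed_tsupport _) hηs
  have hηD := hηs.trans hRD
  have hc0 : 0 ≤ c := (norm_nonneg _).trans (hηg x₀)
  have hq0 : 0 < q := hq.symm.pos
  have hen := hS.energy_le hw0 hRD hk hη hη1 hηs hηg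
  have hSm := measurableSet_closedBall_inter_preimage_Iio hA.continuousOn hRD k
  set S := closedBall x₀ R ∩ w ⁻¹' Iio k with hSdef
  have hrD : closedBall x₀ r ⊆ D := (closedBall_subset_closedBall hrR.le).trans hRD
  have hTm := measurableSet_closedBall_inter_preimage_Iio hA.continuousOn hrD l
  set T := closedBall x₀ r ∩ w ⁻¹' Iio l with hTdef
  have hSfin : volume S ≠ ⊤ := ((measure_mono inter_subset_left).trans_lt
    measure_closedBall_lt_top).ne
  have hTfin : volume T ≠ ⊤ := ((measure_mono inter_subset_left).trans_lt
    measure_closedBall_lt_top).ne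
  have hSD : S ⊆ D := inter_subset_left.trans hRD
  have hμ := hS.pos
  have hlam := hS.lam_pos
  have hh : ∀ s, HasDerivAt (fun s : ℝ => max (k - s) 0 ^ 2)
      ((fun s : ℝ => -(2 * max (k - s) 0)) s) s := fun s => by
    simpa using hasDerivAt_max_sub_zero_pow 0 k s
  have hgns := hA.lintegral_pow_le hq hη hηc hηD hh (by fun_prop)
  have hQint : IntegrableOn (fun x => max (k - w x) 0 ^ 2 * η x ^ 2 * ‖G x‖ ^ 2) D volume :=
    hA.integrableOn_sq_mul_norm_sq hη.continuous hηc hηD (g := fun s => max (k - s) 0 ^ 2)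
      (by fun_prop)
  -- A pointwise majorant of the gradient of η (k - w)₊². Its second part is 2 p |η| |G| ≤ k² + k⁻²
  -- p² η² |G|², which converts the L² energy into an L¹ bound proportional to |S|.
  set g : E → ℝ := fun x => S.indicator (fun _ => k ^ 2 * (c + 1)) x +
    (k ^ 2)⁻¹ * (max (k - w x) 0 ^ 2 * η x ^ 2 * ‖G x‖ ^ 2) with hg
  have hindint : IntegrableOn (S.indicator fun _ => k ^ 2 * (c + 1)) D volume :=
    (integrable_indicator_iff hSm).2
      (integrableOn_const (ne_top_of_le_ne_top hSfin (Measure.restrict_apply_le _ _)))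
  have hgint : IntegrableOn g D volume := hindint.add (hQint.const_mul _)
  have hg0 : ∀ x, 0 ≤ g x := fun x => add_nonneg
    (indicator_nonneg (fun _ _ => by positivity) x) (by positivity)
  have hgI : ∫ x in (D : Set E), g x ≤
      k ^ 2 * (c + 1 + (M * c ^ 2 + lam) / (2 * μ)) * volume.real S := by
    rw [hg, integral_add hindint (hQint.const_mul _), setIntegral_indicator hSm,
      inter_eq_self_of_subset_right hSD, setIntegral_const, smul_eq_mul, integral_const_mul]
    have h1 : (k ^ 2)⁻¹ * ∫ x in (D : Set E), max (k - w x) 0 ^ 2 * η x ^ 2 * ‖G x‖ ^ 2 ≤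
        (k ^ 2)⁻¹ * ((M * c ^ 2 + lam) / (2 * μ) * k ^ 4 * volume.real S) := by gcongr
    have h2 : (k ^ 2)⁻¹ * ((M * c ^ 2 + lam) / (2 * μ) * k ^ 4 * volume.real S) =
        k ^ 2 * ((M * c ^ 2 + lam) / (2 * μ)) * volume.real S := by field_simp
    rw [h2] at h1
    linarith
  have hFle : ∫⁻ x, ‖max (k - w x) 0 ^ 2 • ∇ η x + (η x * -(2 * max (k - w x) 0)) • G x‖ₑ ≤
      ENNReal.ofReal (k ^ 2 * (c + 1 + (M * c ^ 2 + lam) / (2 * μ)) * volume.real S) := by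
    refine le_trans ?_ (ENNReal.ofReal_le_ofReal hgI)
    rw [ofReal_integral_eq_lintegral_ofReal hgint (ae_of_all _ hg0),
      ← lintegral_indicator D.isOpen.measurableSet]
    refine lintegral_mono fun x => ?_
    by_cases hx : x ∈ (D : Set E)
    · rw [indicator_of_mem hx, ← ofReal_norm]
      refine ENNReal.ofReal_le_ofReal ?_
      by_cases hxS : x ∈ S
      · rw [hg]
        simp only [indicator_of_mem hxS]
        have hw := hw0 x hx
        have hp : max (k - w x) 0 ≤ k := max_le (by linarith) hk.le
        have hp0 : 0 ≤ max (k - w x) 0 := le_max_right _ _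
        set p := max (k - w x) 0
        have h1 : ‖p ^ 2 • ∇ η x‖ ≤ k ^ 2 * c := by
          rw [norm_smul, Real.norm_eq_abs, abs_of_nonneg (by positivity)]
          gcongr
          exact hηg x
        have h2 : ‖(η x * -(2 * p)) • G x‖ ≤ k ^ 2 + (k ^ 2)⁻¹ * (p ^ 2 * η x ^ 2 * ‖G x‖ ^ 2) := by
          rw [norm_smul, norm_mul, norm_neg, Real.norm_eq_abs, Real.norm_eq_abs,
            abs_of_nonneg (by positivity : (0 : ℝ) ≤ 2 * p), ← sq_abs (η x)]
          have h3 := sq_nonneg (k - k⁻¹ * (p * |η x| * ‖G x‖))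
          have h4 : k * (k⁻¹ * (p * |η x| * ‖G x‖)) = p * |η x| * ‖G x‖ := by field_simp
          have h5 : (k⁻¹ * (p * |η x| * ‖G x‖)) ^ 2 =
              (k ^ 2)⁻¹ * (p ^ 2 * |η x| ^ 2 * ‖G x‖ ^ 2) := by rw [← inv_pow]; ring
          nlinarith
        have h3 := norm_add_le (p ^ 2 • ∇ η x) ((η x * -(2 * p)) • G x)
        linarith
      · refine le_trans (le_of_eq ?_) (hg0 x)
        rw [norm_eq_zero]
        by_cases hxR : x ∈ closedBall x₀ R
        · have hwk : k ≤ w x := le_of_not_gt fun h => hxS ⟨hxR, h⟩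
          have hp : max (k - w x) 0 = 0 := max_eq_right (by linarith)
          simp [hp]
        · have h1 : η x = 0 := image_eq_zero_of_notMem_tsupport fun h => hxR (hηs h)
          have h2 : ∇ η x = 0 := image_eq_zero_of_notMem_tsupport
            fun h => hxR (hηs (tsupport_gradient_subset _ h))
          simp [h1, h2]
    · have h1 : η x = 0 := image_eq_zero_of_notMem_tsupport fun h => hx (hηD h)
      have h2 : ∇ η x = 0 := image_eq_zero_of_notMem_tsupport
        fun h => hx (hηD (tsupport_gradient_subset _ h))
      simp [h1, h2]
  have hkl : 0 < k - l := sub_pos.2 hlk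
  have hlow : ENNReal.ofReal (((k - l) ^ 2) ^ q) * volume T ≤
      ∫⁻ x, ‖η x * max (k - w x) 0 ^ 2‖ₑ ^ q := by
    calc ENNReal.ofReal (((k - l) ^ 2) ^ q) * volume T
        = ∫⁻ _x in T, ENNReal.ofReal (((k - l) ^ 2) ^ q) := (setLIntegral_const _ _).symm
      _ ≤ ∫⁻ x in T, ‖η x * max (k - w x) 0 ^ 2‖ₑ ^ q := by
          refine setLIntegral_mono' hTm fun x hx => ?_
          have hwl : w x < l := hx.2
          rw [hηr x hx.1, one_mul, Real.enorm_of_nonneg (by positivity),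
            ENNReal.ofReal_rpow_of_nonneg (by positivity) hq0.le]
          refine ENNReal.ofReal_le_ofReal ?_
          have : k - l ≤ max (k - w x) 0 := le_max_of_le_left (by linarith)
          gcongr
      _ ≤ _ := setLIntegral_le_lintegral _ _
  set β := c + 1 + (M * c ^ 2 + lam) / (2 * μ) with hβ
  -- The sign of M comes from a point of D; if S is empty its measure vanishes and the sign is not
  -- needed.
  have hM0 : 0 ≤ M ∨ volume.real S = 0 := by
    by_cases hne : S.Nonempty
    · obtain ⟨x, hx⟩ := hne
      exact Or.inl (hμ.le.trans ((hS.bounds x (hSD hx)).1.trans (hS.bounds x (hSD hx)).2))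
    · rw [not_nonempty_iff_eq_empty] at hne
      exact Or.inr (by simp [hne])
  have hβS : 0 ≤ β * volume.real S := by
    rcases hM0 with h | h
    · positivity
    · rw [h, mul_zero]
  have hfin := (hlow.trans hgns).trans
    (mul_le_mul' le_rfl (ENNReal.rpow_le_rpow hFle hq0.le))
  have hkβ : 0 ≤ k ^ 2 * β * volume.real S := by
    rw [mul_assoc]; positivity
  rw [ENNReal.ofReal_rpow_of_nonneg hkβ hq0.le, ← ENNReal.ofReal_coe_nnreal,
    ← ENNReal.ofReal_mul (NNReal.coe_nonneg _), ← ENNReal.ofReal_toReal hTfin,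
    ← ENNReal.ofReal_mul (by positivity), ENNReal.ofReal_le_ofReal_iff
      (mul_nonneg (NNReal.coe_nonneg _) (Real.rpow_nonneg hkβ _))] at hfin
  have hklq : 0 < ((k - l) ^ 2) ^ q := by positivity
  have hdiv : k ^ 2 / (k - l) ^ 2 * β * volume.real S =
      (k ^ 2 * β * volume.real S) / (k - l) ^ 2 := by ring
  rw [hdiv, Real.div_rpow hkβ (by positivity), ← mul_div_assoc, le_div_iff₀ hklq, mul_comm]
  exact hfin

end DeGiorgiStep

/-! ### The strong maximum principle -/

/-- Bookkeeping for the iteration: radii and levels are R/2 (1 + e) and k/2 (1 + e), where e = 2⁻ʲ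
is halved at each step. This and the next two lemmas bound the cutoff gradient, the level ratio and
the energy constant by powers of 2ʲ. -/
theorem div_radius_gap {A R e : ℝ} (hR : R ≠ 0) (he : e ≠ 0) :
    A / (R / 2 * (1 + e) - R / 2 * (1 + e / 2)) = 4 * A / R * e⁻¹ := by
  have : R / 2 * (1 + e) - R / 2 * (1 + e / 2) = R * e / 4 := by ring
  rw [this]
  field_simp

theorem level_ratio_le {k e : ℝ} (hk : 0 < k) (he : 0 < e) (he1 : e ≤ 1) :
    (k / 2 * (1 + e)) ^ 2 / (k / 2 * (1 + e) - k / 2 * (1 + e / 2)) ^ 2 ≤ 16 * e⁻¹ ^ 2 := by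
  have h1 : k / 2 * (1 + e) - k / 2 * (1 + e / 2) = k * e / 4 := by ring
  have h2 : (k / 2 * (1 + e)) ^ 2 / (k * e / 4) ^ 2 = 4 * (1 + e) ^ 2 * e⁻¹ ^ 2 := by
    field_simp
    ring
  rw [h1, h2]
  gcongr
  nlinarith

theorem quadratic_growth_le {c M lam μ t : ℝ} (hc : 0 ≤ c) (hlam : 0 ≤ lam)
    (hμ : 0 < μ) (ht : 1 ≤ t) :
    c * t + 1 + (M * (c * t) ^ 2 + lam) / (2 * μ) ≤
      (c + 1 + (M * c ^ 2 + lam) / (2 * μ)) * t ^ 2 := by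
  have h3 : 1 ≤ t ^ 2 := one_le_pow₀ ht
  have h4 : t ≤ t ^ 2 := by nlinarith
  have h5 : M * (c * t) ^ 2 + lam ≤ (M * c ^ 2 + lam) * t ^ 2 := by
    have := mul_le_mul_of_nonneg_left h3 hlam
    linarith
  have h6 : (M * (c * t) ^ 2 + lam) / (2 * μ) ≤ (M * c ^ 2 + lam) / (2 * μ) * t ^ 2 :=
    (div_le_div_of_nonneg_right h5 (by positivity)).trans_eq (by ring)
  have h7 := mul_le_mul_of_nonneg_left h4 hc
  linarith

section StrongMaximumPrinciple

variable {E : Type*} [NormedAddCommGroup E] [InnerProductSpace ℝ E] [FiniteDimensional ℝ E]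
  [MeasurableSpace E] [BorelSpace E] {D : Opens E} {w : E → ℝ} {G : E → E} {σ : E → ℝ}
  {μ M lam : ℝ}

/-- De Giorgi: if `w < k` only on a small part of a ball, then `k / 2 ≤ w` on the half ball. -/
theorem IsEllipticSupersolution.exists_measure_threshold
    (hS : IsEllipticSupersolution D σ μ M lam w G) (hw0 : ∀ x ∈ D, 0 ≤ w x)
    (hd : 2 ≤ Module.finrank ℝ E) {x₀ : E} {R : ℝ} (hR : 0 < R) (hRD : closedBall x₀ R ⊆ D) :
    ∃ ν : ℝ, 0 < ν ∧ ∀ k : ℝ, 0 < k → volume.real (closedBall x₀ R ∩ w ⁻¹' Iio k) ≤ ν →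
      k / 2 ≤ w x₀ := by
  obtain ⟨A, hA, hcut⟩ := exists_cutoff_ball E
  have hx₀ : x₀ ∈ D := hRD (mem_closedBall_self hR.le)
  have hμ := hS.pos
  have hlam := hS.lam_pos
  have hM : 0 < M := hμ.trans_le ((hS.bounds x₀ hx₀).1.trans (hS.bounds x₀ hx₀).2)
  have hw := hS.hasC1Approx.continuousOn
  set q : ℝ := Real.conjExponent (Module.finrank ℝ E) with hqdef
  have hd1 : (1 : ℝ) < Module.finrank ℝ E := by exact_mod_cast hd
  have hq : Real.HolderConjugate (Module.finrank ℝ E) q := Real.HolderConjugate.conjExponent hd1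
  have hq1 : 1 < q := hq.symm.lt
  have hq0 : 0 < q := hq.symm.pos
  set Cq : ℝ := ↑(lintegralPowLePowLIntegralFDerivConst (volume : Measure E) q) with hCq
  have hCq0 : 0 ≤ Cq := NNReal.coe_nonneg _
  set c₀ : ℝ := 4 * A / R with hc₀
  have hc₀0 : 0 < c₀ := by positivity
  set β : ℝ := c₀ + 1 + (M * c₀ ^ 2 + lam) / (2 * μ) with hβ
  have hβ0 : 0 < β := by positivity
  -- The level ratio costs 16 · 4ʲ and the energy constant β · 4ʲ, giving 16β · 16ʲ and hence b =
  -- 16. Adding 1 to `Cq` ensures K > 0. Nothing here depends on k, so neither does the threshold.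
  set K : ℝ := (Cq + 1) * (16 * β) ^ q with hK
  have hK0 : 0 < K := by positivity
  obtain ⟨ν, hν, hconv⟩ := exists_threshold_tendsto_zero (K := K) (b := 16) (q := q) hK0
    (by norm_num) hq1
  refine ⟨ν, hν, fun k hk hVk => ?_⟩
  set e : ℕ → ℝ := fun j => (1 / 2) ^ j with he
  have he0 : ∀ j, 0 < e j := fun j => by positivity
  have he1 : ∀ j, e j ≤ 1 := fun j => pow_le_one₀ (by norm_num) (by norm_num)
  have hes : ∀ j, e (j + 1) = e j / 2 := fun j => by simp only [he, pow_succ]; ring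
  have hei : ∀ j, (e j)⁻¹ = 2 ^ j := fun j => by simp [he]
  set V : ℕ → ℝ := fun j =>
    volume.real (closedBall x₀ (R / 2 * (1 + e j)) ∩ w ⁻¹' Iio (k / 2 * (1 + e j))) with hV
  have hV0 : ∀ j, 0 ≤ V j := fun j => measureReal_nonneg
  have hstep : ∀ j, V (j + 1) ≤ K * (16 ^ j * V j) ^ q := by
    intro j
    have hej := he0 j
    have hej1 := he1 j
    have hr : R / 2 * (1 + e (j + 1)) < R / 2 * (1 + e j) := by
      rw [hes]; gcongr; linarith
    have hl : k / 2 * (1 + e (j + 1)) < k / 2 * (1 + e j) := by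
      rw [hes]; gcongr; linarith
    obtain ⟨ζ, hζ, hζ0, hζle, hζ1, hζs, hζg⟩ := hcut x₀ (R / 2 * (1 + e (j + 1)))
      (R / 2 * (1 + e j)) (mul_nonneg (by positivity) (by linarith [he0 (j + 1)])) hr
    have hcj : A / (R / 2 * (1 + e j) - R / 2 * (1 + e (j + 1))) = c₀ * 2 ^ j := by
      rw [hes, hc₀, ← hei]
      exact div_radius_gap hR.ne' hej.ne'
    rw [hcj] at hζg
    have hsubD : closedBall x₀ (R / 2 * (1 + e j)) ⊆ D :=
      (closedBall_subset_closedBall ((mul_le_mul_of_nonneg_left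
        (add_le_add_right hej1 1) (half_pos hR).le).trans_eq (by ring))).trans hRD
    have hst := hS.deGiorgi_step hw0 hq hr hsubD (k := k / 2 * (1 + e j)) (by positivity) hl hζ
      (fun x => by rw [abs_of_nonneg (hζ0 x)]; exact hζle x) hζ1 hζs hζg
    refine hst.trans ?_
    have h2j : (1 : ℝ) ≤ 2 ^ j := one_le_pow₀ (by norm_num)
    have hratio : (k / 2 * (1 + e j)) ^ 2 /
        (k / 2 * (1 + e j) - k / 2 * (1 + e (j + 1))) ^ 2 ≤ 16 * (2 ^ j) ^ 2 := by
      rw [hes, ← hei]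
      exact level_ratio_le hk hej hej1
    have hββ : c₀ * 2 ^ j + 1 + (M * (c₀ * 2 ^ j) ^ 2 + lam) / (2 * μ) ≤ β * (2 ^ j) ^ 2 :=
      quadratic_growth_le hc₀0.le hlam.le hμ h2j
    have h16 : (16 : ℝ) ^ j = (2 ^ j) ^ 2 * (2 ^ j) ^ 2 := by
      rw [← pow_add, ← pow_mul, mul_comm j, pow_mul]; norm_num
    calc Cq * ((k / 2 * (1 + e j)) ^ 2 / (k / 2 * (1 + e j) - k / 2 * (1 + e (j + 1))) ^ 2 *
          (c₀ * 2 ^ j + 1 + (M * (c₀ * 2 ^ j) ^ 2 + lam) / (2 * μ)) * V j) ^ q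
        ≤ (Cq + 1) * (16 * (2 ^ j) ^ 2 * (β * (2 ^ j) ^ 2) * V j) ^ q := by
          have := hV0 j
          gcongr
          linarith
      _ = K * (16 ^ j * V j) ^ q := by
          rw [hK, h16, mul_assoc (Cq + 1), ← Real.mul_rpow (by positivity)
            (mul_nonneg (by positivity) (hV0 j))]
          congr 2
          ring
  have hlim := hconv V hV0 hstep (by
    have h1 : R / 2 * (1 + e 0) = R := by simp [he]; ring
    have h2 : k / 2 * (1 + e 0) = k := by simp [he]; ring
    simpa only [hV, h1, h2] using hVk)
  by_contra! hlt
  -- If w x₀ < k/2, this nonempty open set lies in every set of the iteration, so V j could not tend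
  -- to 0.
  set U : Set E := ball x₀ (R / 2) ∩ w ⁻¹' Iio (k / 2) with hU
  have hball : ball x₀ (R / 2) ⊆ D := (ball_subset_closedBall).trans
    ((closedBall_subset_closedBall (by linarith)).trans hRD)
  have hUo : IsOpen U := (hw.mono hball).isOpen_inter_preimage isOpen_ball isOpen_Iio
  have hxU : x₀ ∈ U := ⟨mem_ball_self (by positivity), hlt⟩
  have hUfin : volume U ≠ ⊤ := ((measure_mono inter_subset_left).trans_lt measure_ball_lt_top).ne
  have hUpos : 0 < volume.real U := ENNReal.toReal_pos (hUo.measure_pos volume ⟨x₀, hxU⟩).ne' hUfin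
  have hUV : ∀ j, volume.real U ≤ V j := fun j => by
    refine measureReal_mono (inter_subset_inter ?_ ?_)
      ((measure_mono inter_subset_left).trans_lt measure_closedBall_lt_top).ne
    · exact ball_subset_closedBall.trans (closedBall_subset_closedBall
        (le_mul_of_one_le_right (half_pos hR).le (le_add_of_nonneg_right (he0 j).le)))
    · exact preimage_mono (Iio_subset_Iio
        (le_mul_of_one_le_right (half_pos hk).le (le_add_of_nonneg_right (he0 j).le)))
  exact absurd (ge_of_tendsto' hlim hUV) (not_le.2 hUpos)

/-- A supersolution that is positive somewhere in a ball has a null zero set there. -/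
theorem IsEllipticSupersolution.volume_zero_set_eq_zero
    (hS : IsEllipticSupersolution D σ μ M lam w G) (hw0 : ∀ x ∈ D, 0 ≤ w x) {x₀ : E} {r R : ℝ}
    (hr : 0 < r) (hrR : r < R) (hRD : closedBall x₀ R ⊆ D) (hpos : ∃ y ∈ ball x₀ r, 0 < w y) :
    volume (ball x₀ r ∩ w ⁻¹' Iic 0) = 0 := by
  obtain ⟨y, hy, hwy⟩ := hpos
  have hA := hS.hasC1Approx
  have hw := hA.continuousOn
  have hμ := hS.pos
  have hlam := hS.lam_pos
  have hBD : ball x₀ r ⊆ D := ball_subset_closedBall.trans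
    ((closedBall_subset_closedBall hrR.le).trans hRD)
  have hx₀ : x₀ ∈ D := hBD (mem_ball_self hr)
  have hM : 0 < M := hμ.trans_le ((hS.bounds x₀ hx₀).1.trans (hS.bounds x₀ hx₀).2)
  have hBm : MeasurableSet (ball x₀ r) := measurableSet_ball
  have hBIio : ∀ t, MeasurableSet (ball x₀ r ∩ w ⁻¹' Iio t) := fun t =>
    ((hw.mono hBD).isOpen_inter_preimage isOpen_ball isOpen_Iio).measurableSet
  have hBIoi : ∀ t, MeasurableSet (ball x₀ r ∩ w ⁻¹' Ioi t) := fun t =>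
    ((hw.mono hBD).isOpen_inter_preimage isOpen_ball isOpen_Ioi).measurableSet
  have hfin : ∀ {s : Set E}, s ⊆ ball x₀ r → volume s ≠ ⊤ := fun hs =>
    ((measure_mono hs).trans_lt measure_ball_lt_top).ne
  obtain ⟨A, hA0, hcut⟩ := exists_cutoff_ball E
  obtain ⟨η, hη, hη0, hηle, hη1, hηs, hηg⟩ := hcut x₀ r R hr.le hrR
  obtain ⟨B, hB0, hB⟩ := exists_deriv_smoothTransition_bound
  set k₀ := w y / 2 with hk₀
  have hk₀0 : 0 < k₀ := by positivity
  set Z := ball x₀ r ∩ w ⁻¹' Iic 0 with hZ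
  set T := ball x₀ r ∩ w ⁻¹' Ioi k₀ with hT
  have hZm : MeasurableSet Z := by
    have : Z = ball x₀ r \ (ball x₀ r ∩ w ⁻¹' Ioi 0) := by
      ext x
      simp only [hZ, mem_inter_iff, mem_preimage, mem_Iic, Set.mem_sdiff, mem_Ioi, not_and, not_lt]
      exact ⟨fun h => ⟨h.1, fun _ => h.2⟩, fun h => ⟨h.1, h.2 h.1⟩⟩
    rw [this]
    exact hBm.diff (hBIoi 0)
  have hTpos : volume T ≠ 0 := by
    have hTo : IsOpen T := (hw.mono hBD).isOpen_inter_preimage isOpen_ball isOpen_Ioi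
    exact (hTo.measure_pos volume ⟨y, hy, by simp only [mem_preimage, mem_Ioi]; linarith⟩).ne'
  set P : Set E := ball x₀ r ∩ w ⁻¹' Ioi 0 with hP
  have hPm : MeasurableSet P := hBIoi 0
  have hPk : ∀ t, MeasurableSet (P ∩ w ⁻¹' Iio t) := fun t => by
    have : P ∩ w ⁻¹' Iio t = (ball x₀ r ∩ w ⁻¹' Iio t) ∩ P := by
      ext x; simp only [hP, mem_inter_iff]; tauto
    rw [this]
    exact (hBIio t).inter hPm
  set c := A / (R - r) with hc
  -- The energy at level 2k is at most k⁴ e₀; the factor 2⁴ comes from (2k)⁴.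
  set e₀ : ℝ := (M * c ^ 2 + lam) / (2 * μ) * 2 ^ 4 * volume.real (closedBall x₀ R) with he₀
  have he₀0 : 0 ≤ e₀ := by positivity
  set Cp := 2 * (ENNReal.ofReal (2 * r) * volume (ball (0 : E) (2 * r))) with hCp
  have hCptop : Cp ≠ ⊤ := ENNReal.mul_ne_top (by simp)
    (ENNReal.mul_ne_top ENNReal.ofReal_ne_top measure_ball_lt_top.ne)
  -- Poincaré for a function of w equal to 1 on Z and 0 on T, with slope at most B/k, supported in 0
  -- < w < k. Young's inequality with weight t splits B k⁻¹ |G| into t k⁻² |G|² and B²/t. The energy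
  -- is taken at level 2k because (2k - w)₊ ≥ k where w < k.
  have main : ∀ k, 0 < k → k ≤ k₀ → ∀ t, 0 < t → volume Z * volume T ≤
      Cp * ENNReal.ofReal (t * e₀ + B ^ 2 / t * volume.real (P ∩ w ⁻¹' Iio k)) := by
    intro k hk hkk t ht
    set h : ℝ → ℝ := fun s => Real.smoothTransition (1 - k⁻¹ * s) with hh
    set h' : ℝ → ℝ := fun s => deriv Real.smoothTransition (1 - k⁻¹ * s) * -(k⁻¹ * 1) with hh'
    have hst1 : ContDiff ℝ 1 Real.smoothTransition := Real.smoothTransition.contDiff (n := 1)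
    have hder : ∀ s, HasDerivAt h (h' s) s := fun s => by
      have h1 : HasDerivAt Real.smoothTransition (deriv Real.smoothTransition (1 - k⁻¹ * s))
          (1 - k⁻¹ * s) := (hst1.differentiable (by simp) _).hasDerivAt
      exact h1.comp s (((hasDerivAt_id s).const_mul k⁻¹).const_sub 1)
    have hst' : Continuous (deriv Real.smoothTransition) := hst1.continuous_deriv (by simp)
    have hcont' : Continuous h' := by
      rw [hh']
      fun_prop
    have hZ1 : ∀ x ∈ Z, h (w x) = 1 := fun x hx =>
      Real.smoothTransition.one_of_one_le (by
        have : w x ≤ 0 := hx.2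
        have h2 : k⁻¹ * w x ≤ 0 := mul_nonpos_of_nonneg_of_nonpos (by positivity) this
        linarith)
    have hT0 : ∀ x ∈ T, h (w x) = 0 := fun x hx =>
      Real.smoothTransition.zero_of_nonpos (by
        have h1 : k₀ < w x := hx.2
        have h2 : 1 ≤ k⁻¹ * w x := by
          rw [le_inv_mul_iff₀ hk]; linarith
        linarith)
    have hpoin := hA.volume_mul_volume_le hr.le hrR hRD hder hcont' hZm (hBIoi k₀)
      inter_subset_left inter_subset_left hZ1 hT0
    refine hpoin.trans (mul_le_mul' le_rfl ?_)
    have hen := hS.energy_le hw0 hRD (k := 2 * k) (by positivity) hη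
      (fun x => by rw [abs_of_nonneg (hη0 x)]; exact hηle x) hηs hηg
    have hηc : HasCompactSupport η :=
      (isCompact_closedBall x₀ R).of_isClosed_subset (isClosed_tsupport _) hηs
    have hQint : IntegrableOn (fun x => max (2 * k - w x) 0 ^ 2 * η x ^ 2 * ‖G x‖ ^ 2) D volume :=
      hA.integrableOn_sq_mul_norm_sq hη.continuous hηc (hηs.trans hRD)
        (g := fun s => max (2 * k - s) 0 ^ 2) (by fun_prop)
    set Q : E → ℝ := fun x => max (2 * k - w x) 0 ^ 2 * η x ^ 2 * ‖G x‖ ^ 2 with hQ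
    have hQ0 : ∀ x, 0 ≤ Q x := fun x => by positivity
    set g : E → ℝ := fun x => t * (k ^ 4)⁻¹ * Q x +
      (P ∩ w ⁻¹' Iio k).indicator (fun _ => B ^ 2 / t) x with hg
    have hg0 : ∀ x, 0 ≤ g x := fun x => add_nonneg (mul_nonneg (by positivity) (hQ0 x))
      (indicator_nonneg (fun _ _ => by positivity) x)
    have hPsub : P ∩ w ⁻¹' Iio k ⊆ ball x₀ r := inter_subset_left.trans inter_subset_left
    have hind : IntegrableOn ((P ∩ w ⁻¹' Iio k).indicator fun _ => B ^ 2 / t) (ball x₀ r)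
        volume := (integrable_indicator_iff (hPk k)).2
      (integrableOn_const (ne_top_of_le_ne_top (hfin hPsub) (Measure.restrict_apply_le _ _)))
    have hQB : IntegrableOn (fun x => t * (k ^ 4)⁻¹ * Q x) (ball x₀ r) volume :=
      (hQint.mono_set hBD).const_mul _
    have hgint : IntegrableOn g (ball x₀ r) volume := hQB.add hind
    have hgI : ∫ x in ball x₀ r, g x ≤
        t * e₀ + B ^ 2 / t * volume.real (P ∩ w ⁻¹' Iio k) := by
      rw [hg, integral_add hQB hind, setIntegral_indicator (hPk k),
        inter_eq_self_of_subset_right hPsub, setIntegral_const, smul_eq_mul, integral_const_mul]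
      have h1 : ∫ x in ball x₀ r, Q x ≤ ∫ x in (D : Set E), Q x :=
        setIntegral_mono_set hQint (ae_of_all _ hQ0) (ae_of_all _ hBD)
      have h2 : volume.real (closedBall x₀ R ∩ w ⁻¹' Iio (2 * k)) ≤
          volume.real (closedBall x₀ R) :=
        measureReal_mono inter_subset_left measure_closedBall_lt_top.ne
      have h3 : ∫ x in ball x₀ r, Q x ≤ k ^ 4 * e₀ := by
        refine (h1.trans hen).trans ?_
        calc (M * c ^ 2 + lam) / (2 * μ) * (2 * k) ^ 4 *
              volume.real (closedBall x₀ R ∩ w ⁻¹' Iio (2 * k))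
            ≤ (M * c ^ 2 + lam) / (2 * μ) * (2 * k) ^ 4 * volume.real (closedBall x₀ R) := by
              gcongr
          _ = k ^ 4 * e₀ := by rw [he₀]; ring
      have h4 : t * (k ^ 4)⁻¹ * ∫ x in ball x₀ r, Q x ≤ t * (k ^ 4)⁻¹ * (k ^ 4 * e₀) := by gcongr
      have h5 : t * (k ^ 4)⁻¹ * (k ^ 4 * e₀) = t * e₀ := by field_simp
      rw [h5] at h4
      linarith
    refine le_trans ?_ (ENNReal.ofReal_le_ofReal hgI)
    rw [ofReal_integral_eq_lintegral_ofReal hgint (ae_of_all _ hg0)]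
    refine setLIntegral_mono' hBm fun x hx => ?_
    rw [← ofReal_norm]
    refine ENNReal.ofReal_le_ofReal ?_
    -- At the endpoints too the derivative vanishes, since the transition attains its extreme values
    -- there.
    have hderiv0 : ∀ s, (s ≤ 0 ∨ k ≤ s) → h' s = 0 := by
      have hmin : ∀ z, z ≤ 0 → deriv Real.smoothTransition z = 0 := fun z hz => by
        refine IsLocalMin.deriv_eq_zero (Eventually.of_forall fun a => ?_)
        rw [Real.smoothTransition.zero_of_nonpos hz]
        exact Real.smoothTransition.nonneg a
      have hmax : ∀ z, 1 ≤ z → deriv Real.smoothTransition z = 0 := fun z hz => by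
        refine IsLocalMax.deriv_eq_zero (Eventually.of_forall fun a => ?_)
        rw [Real.smoothTransition.one_of_one_le hz]
        exact Real.smoothTransition.le_one a
      rintro s (hs | hs)
      · have h2 : k⁻¹ * s ≤ 0 := mul_nonpos_of_nonneg_of_nonpos (by positivity) hs
        rw [hh']
        simp only
        rw [hmax _ (by linarith), zero_mul]
      · have h2 : 1 ≤ k⁻¹ * s := by rw [le_inv_mul_iff₀ hk]; linarith
        rw [hh']
        simp only
        rw [hmin _ (by linarith), zero_mul]
    by_cases hxP : x ∈ P ∩ w ⁻¹' Iio k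
    · rw [hg]
      simp only [indicator_of_mem hxP]
      have hwk : w x < k := hxP.2
      have h1 : k ≤ max (2 * k - w x) 0 := le_max_of_le_left (by linarith)
      have h2 : k ^ 2 * ‖G x‖ ^ 2 ≤ Q x := by
        rw [hQ]
        simp only
        rw [hη1 x (ball_subset_closedBall hx), one_pow, mul_one]
        gcongr
      have h3 : |h' (w x)| ≤ B * k⁻¹ := by
        rw [hh']
        simp only
        rw [abs_mul, abs_neg, mul_one, abs_of_pos (inv_pos.2 hk)]
        gcongr
        exact hB _
      have h4 : t * (k ^ 4)⁻¹ * (k ^ 2 * ‖G x‖ ^ 2) ≤ t * (k ^ 4)⁻¹ * Q x := by gcongr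
      have h5 : t * (k ^ 4)⁻¹ * (k ^ 2 * ‖G x‖ ^ 2) = t * (k⁻¹ * ‖G x‖) ^ 2 := by field_simp
      have h6 : B * (k⁻¹ * ‖G x‖) ≤ t * (k⁻¹ * ‖G x‖) ^ 2 + B ^ 2 / t := by
        have h7 : 0 ≤ t * (k⁻¹ * ‖G x‖) ^ 2 + B ^ 2 / t - 2 * (B * (k⁻¹ * ‖G x‖)) := by
          have : t * (k⁻¹ * ‖G x‖) ^ 2 + B ^ 2 / t - 2 * (B * (k⁻¹ * ‖G x‖)) =
              (t * (k⁻¹ * ‖G x‖) - B) ^ 2 / t := by field_simp; ring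
          rw [this]
          positivity
        have h8 : 0 ≤ B * (k⁻¹ * ‖G x‖) := by positivity
        linarith
      calc ‖h' (w x) • G x‖ ≤ B * k⁻¹ * ‖G x‖ := by
            rw [norm_smul, Real.norm_eq_abs]
            gcongr
        _ ≤ _ := by
            rw [mul_assoc]
            linarith
    · have : h' (w x) = 0 := by
        refine hderiv0 _ ?_
        by_contra! hcon
        exact hxP ⟨⟨hx, hcon.1⟩, hcon.2⟩
      rw [this, zero_smul, norm_zero]
      exact hg0 x
  have hPlim : Tendsto (fun k => volume.real (P ∩ w ⁻¹' Iio k)) (𝓝[>] 0) (𝓝 0) := by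
    have h1 := tendsto_measure_inter_preimage_Iio (ν := volume) hPk (hfin inter_subset_left)
    have h2 : P ∩ w ⁻¹' Iic 0 = ∅ := by
      refine eq_empty_of_forall_notMem fun x hx => ?_
      have h3 : 0 < w x := hx.1.2
      exact h3.not_ge hx.2
    rw [h2, measure_empty] at h1
    exact (ENNReal.tendsto_toReal ENNReal.zero_ne_top).comp h1
  -- The order of limits matters: k → 0 at fixed t removes the term with 1/t, and only then t → 0.
  have step2 : ∀ t, 0 < t → volume Z * volume T ≤ Cp * ENNReal.ofReal (t * e₀) := by
    intro t ht
    have hl : Tendsto (fun k => Cp * ENNReal.ofReal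
        (t * e₀ + B ^ 2 / t * volume.real (P ∩ w ⁻¹' Iio k))) (𝓝[>] 0)
        (𝓝 (Cp * ENNReal.ofReal (t * e₀ + B ^ 2 / t * 0))) :=
      ENNReal.Tendsto.const_mul (ENNReal.tendsto_ofReal
        (tendsto_const_nhds.add (hPlim.const_mul _))) (Or.inr hCptop)
    rw [mul_zero, add_zero] at hl
    refine ge_of_tendsto hl ?_
    filter_upwards [Ioc_mem_nhdsGT hk₀0] with k hk
    exact main k hk.1 hk.2 t ht
  have step3 : volume Z * volume T ≤ 0 := by
    have hl : Tendsto (fun t : ℝ => Cp * ENNReal.ofReal (t * e₀)) (𝓝[>] 0)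
        (𝓝 (Cp * ENNReal.ofReal (0 * e₀))) :=
      ENNReal.Tendsto.const_mul (ENNReal.tendsto_ofReal
        ((tendsto_id.mono_left nhdsWithin_le_nhds).mul_const _)) (Or.inr hCptop)
    rw [zero_mul, ENNReal.ofReal_zero, mul_zero] at hl
    refine ge_of_tendsto hl ?_
    filter_upwards [self_mem_nhdsWithin] with t ht
    exact step2 t ht
  exact (mul_eq_zero.1 (le_antisymm step3 bot_le)).resolve_right hTpos

/-- A nonnegative supersolution that is positive at points arbitrarily close to `x₀` is positive at
`x₀`. -/
theorem IsEllipticSupersolution.pos_of_mem_closure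
    (hS : IsEllipticSupersolution D σ μ M lam w G) (hw0 : ∀ x ∈ D, 0 ≤ w x)
    (hd : 2 ≤ Module.finrank ℝ E) {x₀ : E} (hx₀ : x₀ ∈ D)
    (hcl : x₀ ∈ closure {y | 0 < w y}) : 0 < w x₀ := by
  obtain ⟨R, hR, hRD⟩ := nhds_basis_closedBall.mem_iff.1 (D.isOpen.mem_nhds hx₀)
  obtain ⟨y, hy, hyb⟩ := Metric.mem_closure_iff.1 hcl (R / 2) (by positivity)
  have hnull := hS.volume_zero_set_eq_zero hw0 (r := R / 2) (by positivity) (half_lt_self hR) hRD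
    ⟨y, by rwa [mem_ball, dist_comm], hy⟩
  -- The closed ball of radius R/4 lies inside the open ball of radius R/2, where the zero set is
  -- null.
  have hRD' : closedBall x₀ (R / 4) ⊆ D :=
    (closedBall_subset_closedBall (by linarith)).trans hRD
  obtain ⟨ν, hν, hth⟩ := hS.exists_measure_threshold hw0 hd (R := R / 4) (by positivity) hRD'
  have hlim := tendsto_measure_inter_preimage_Iio (ν := volume)
    (measurableSet_closedBall_inter_preimage_Iio hS.hasC1Approx.continuousOn hRD')
    measure_closedBall_lt_top.ne
  have hz : volume (closedBall x₀ (R / 4) ∩ w ⁻¹' Iic 0) = 0 :=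
    measure_mono_null (inter_subset_inter_left _ (closedBall_subset_ball (by linarith))) hnull
  rw [hz] at hlim
  have hlim' := (ENNReal.tendsto_toReal ENNReal.zero_ne_top).comp hlim
  obtain ⟨k, hk, hk0⟩ := ((hlim'.eventually_le_const (u := ν) (by simpa using hν)).and
    self_mem_nhdsWithin).exists
  have hk0' : 0 < k := hk0
  have := hth k hk0' hk
  linarith

/-- The strong maximum principle. -/
theorem IsEllipticSupersolution.pos_or_eq_zero
    (hS : IsEllipticSupersolution D σ μ M lam w G) (hw0 : ∀ x ∈ D, 0 ≤ w x)
    (hd : 2 ≤ Module.finrank ℝ E) (hD : IsPreconnected (D : Set E)) :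
    (∀ x ∈ D, 0 < w x) ∨ ∀ x ∈ D, w x = 0 := by
  have hw := hS.hasC1Approx.continuousOn
  by_cases hex : ∃ y ∈ D, 0 < w y
  · left
    obtain ⟨y, hyD, hy⟩ := hex
    have hopen : IsOpen ((D : Set E) ∩ w ⁻¹' Ioi 0) :=
      hw.isOpen_inter_preimage D.isOpen isOpen_Ioi
    -- The positivity set is open and, by `pos_of_mem_closure`, contains its limit points in D, so
    -- it fills the connected set D.
    have hsub := hD.subset_of_closure_inter_subset hopen ⟨y, hyD, hyD, hy⟩ (by
      rintro x ⟨hxc, hxD⟩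
      exact ⟨hxD, hS.pos_of_mem_closure hw0 hd hxD (closure_mono inter_subset_right hxc)⟩)
    exact fun x hx => (hsub hx).2
  · right
    push Not at hex
    exact fun x hx => le_antisymm (hex x hx) (hw0 x hx)

end StrongMaximumPrinciple

/-! ### From the essential bound to the theorem -/

/-- A violation at one point would persist on a nonempty open set, which has positive measure. -/
theorem abs_le_of_ae_bound_of_continuousOn {E : Type*} [TopologicalSpace E] [MeasureSpace E]
    [OpensMeasurableSpace E] [(volume : Measure E).IsOpenPosMeasure] {D : Opens E} {w : E → ℝ}
    (hw : ContinuousOn w D) {C : ℝ} (hC : ∀ᵐ x ∂(volume.restrict (D : Set E)), |w x| ≤ C) :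
    ∀ x ∈ D, |w x| ≤ C := by
  intro x hx
  by_contra! hlt
  have hU : IsOpen ((D : Set E) ∩ (fun x => |w x|) ⁻¹' Ioi C) :=
    hw.abs.isOpen_inter_preimage D.isOpen isOpen_Ioi
  have h1 := hU.measure_pos volume ⟨x, hx, hlt⟩
  rw [ae_restrict_iff' D.isOpen.measurableSet, ae_iff] at hC
  refine h1.ne' (measure_mono_null (fun y hy => ?_) hC)
  simp only [Set.mem_ofPred_eq, not_forall, not_le]
  exact ⟨hy.1, hy.2⟩

theorem propositionA3 (N : ℕ) (hN : 2 ≤ N)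
    (D : Opens (EuclideanSpace ℝ (Fin N)))
    (hDconn : IsConnected (D : Set (EuclideanSpace ℝ (Fin N))))
    (hDunb : ¬ Bornology.IsBounded (D : Set (EuclideanSpace ℝ (Fin N))))
    (σ : EuclideanSpace ℝ (Fin N) → ℝ)
    (hσmeas : AEMeasurable σ (volume.restrict (D : Set (EuclideanSpace ℝ (Fin N)))))
    (μ M : ℝ) (hμ : 0 < μ)
    (hσ : ∀ x ∈ D, μ ≤ σ x ∧ σ x ≤ M)
    (lam : ℝ) (hlam : 0 < lam)
    (w : EuclideanSpace ℝ (Fin N) → ℝ)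
    (hwH1 : MemH1Loc D w)
    (hwbdd : MemLp w ⊤ (volume.restrict (D : Set (EuclideanSpace ℝ (Fin N)))))
    (hwcont : ContinuousOn w (closure (D : Set (EuclideanSpace ℝ (Fin N)))))
    (hwsuper : IsWeakSupersolution D σ lam w)
    (hwbdry : ∀ x ∈ frontier (D : Set (EuclideanSpace ℝ (Fin N))), 0 ≤ w x) :
    (∀ x ∈ D, 0 ≤ w x) ∧ ((∀ x ∈ D, 0 < w x) ∨ (∀ x ∈ D, w x = 0)) := by
  obtain ⟨G, hG, hweak⟩ := hwsuper
  have hwD : ContinuousOn w D := hwcont.mono subset_closure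
  have hS : IsEllipticSupersolution D σ μ M lam w G :=
    ⟨hG.hasC1Approx hwD, hσmeas, hμ, hσ, hlam, hweak⟩
  have hC : ∀ x ∈ D, |w x| ≤
      (eLpNorm w ⊤ (volume.restrict (D : Set (EuclideanSpace ℝ (Fin N))))).toReal := by
    refine abs_le_of_ae_bound_of_continuousOn hwD ?_
    rw [eLpNorm_exponent_top]
    filter_upwards [ae_le_eLpNormEssSup (f := w)
      (μ := volume.restrict (D : Set (EuclideanSpace ℝ (Fin N))))] with x hx
    rw [← Real.norm_eq_abs, ← toReal_enorm]
    exact ENNReal.toReal_mono (by simpa [eLpNorm_exponent_top] using hwbdd.2.ne) hx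
  have hnonneg := hS.nonneg hC hwcont hwbdry
  exact ⟨hnonneg, hS.pos_or_eq_zero hnonneg (by simpa using hN) hDconn.isPreconnected⟩
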